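/- Let $G$ be a finite, simple, connected cubic graph of girth $5$ whose adjacency matrix has no eigenvalue in the open interval $(-2,0)$. Then $G$ is isomorphic to the Petersen graph or to the graph of the dodecahedron. -/

import Mathlib

/-- The generalized Petersen graph `GP(n, k)`: outer vertices `inl i` and inner vertices `inr i`
for `i : ZMod n`, with an outer cycle `inl i ~ inl (i + 1)`, spokes `inl i ~ inr i`, and inner
edges `inr i ~ inr (i + k)`. -/
def generalizedPetersenGraph (n k : ℕ) : SimpleGraph (ZMod n ⊕ ZMod n) :=
  SimpleGraph.fromRel fun x y =>
    match x, y with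
    | .inl i, .inl j => j = i + 1
    | .inl i, .inr j => j = i
    | .inr i, .inr j => j = i + (k : ZMod n)
    | .inr _, .inl _ => False

/-- The Petersen graph, as `GP(5, 2)`: an outer pentagon joined by spokes to an inner pentagram. -/
def petersenGraph : SimpleGraph (ZMod 5 ⊕ ZMod 5) := generalizedPetersenGraph 5 2

/-- The dodecahedron, i.e. the graph of vertices and edges of the regular dodecahedron,
as `GP(10, 2)`: the inner vertices form two pentagons (two opposite faces), one on the even
and one on the odd indices, each joined by spokes to the alternate vertices of the `10`-cycle
that separates them. -/
def dodecahedronGraph : SimpleGraph (ZMod 10 ⊕ ZMod 10) := generalizedPetersenGraph 10 2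

/-! Let `A` be the adjacency matrix. Since `μ ^ 2 + 2 μ` is negative only for `μ` in the gap, `A ^ 2
+ 2 A` is positive semidefinite. Evaluated at `(A + β) (e_a - e_c)` for a path `a`, `b`, `c`, this
bounds the number of 4-walks from `a` to `c` in terms of the number of 3-walks: pentagons at the
path control hexagons at it.

If the path is open (lies on no pentagon), `β = -2` rules out every hexagon there and makes the form
vanish. The test vector is then in the kernel, and `a` and `c` have 3-walks to the same vertices
(`threeWalk_congr`). If the path lies on exactly one pentagon, `β = -3/2` leaves at most one vertex
opposite to `b` in a hexagon (`hexAt_unique`).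

The rest is combinatorial. The congruence spreads pentagons to all vertices and prolongs an open
path at its ends until a contradiction appears (`not_openAngle`), so every path on three vertices
lies on a pentagon. If that pentagon is always unique, the pentagons fit together like the faces of
a dodecahedron. Otherwise two pentagons share a path, and a local analysis (`IsTheta`) forces the
Petersen graph. In both cases a homomorphism from the model graph is injective, because a collision
would create a short cycle or a second pentagon; regularity and connectedness make it an
isomorphism. -/

open Matrix in
/-- If a symmetric real matrix `A` has no eigenvalue in `(-2, 0)`, then `A ^ 2 + 2 A` is positive
semidefinite. -/
theorem Matrix.IsHermitian.posSemidef_mul_self_add_two_smul {n : Type*} [Fintype n] [DecidableEq n]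
    {A : Matrix n n ℝ} (hA : A.IsHermitian)
    (h : ∀ μ : ℝ, Module.End.HasEigenvalue (Matrix.toLin' A) μ → μ ∉ Set.Ioo (-2 : ℝ) 0) :
    (A * A + (2 : ℝ) • A).PosSemidef := by
  have hd : ∀ i, 0 ≤ hA.eigenvalues i * hA.eigenvalues i + 2 * hA.eigenvalues i := by
    intro i
    have h1 : Module.End.HasEigenvalue (Matrix.toLin' A) (hA.eigenvalues i) := by
      apply Module.End.hasEigenvalue_of_hasEigenvector (x := ⇑(hA.eigenvectorBasis i))
      rw [Module.End.hasEigenvector_iff, Module.End.mem_eigenspace_iff]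
      refine ⟨by simpa using hA.mulVec_eigenvectorBasis i, ?_⟩
      exact (WithLp.ofLp_eq_zero 2).ne.2 <| hA.eigenvectorBasis.orthonormal.ne_zero i
    have h2 := h _ h1
    simp only [Set.mem_Ioo, not_and, not_lt] at h2
    by_cases h3 : -2 < hA.eigenvalues i
    · have := h2 h3
      positivity
    · nlinarith
  set U : Matrix n n ℝ := (hA.eigenvectorUnitary : Matrix n n ℝ)
  set D : Matrix n n ℝ := diagonal hA.eigenvalues
  have hU : star U * U = 1 := Unitary.coe_star_mul_self _
  have hs : A = U * D * star U := by
    conv_lhs => rw [hA.spectral_theorem, Unitary.conjStarAlgAut_apply]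
    rfl
  have h4 : A * A + (2 : ℝ) • A = U * (D * D + (2 : ℝ) • D) * star U := by
    rw [hs]
    calc _ = U * D * (star U * U) * D * star U + (2 : ℝ) • (U * D * star U) := by
            simp only [Matrix.mul_assoc]
      _ = _ := by rw [hU]; simp [Matrix.mul_add, Matrix.add_mul, Matrix.mul_assoc]
  rw [h4, star_eq_conjTranspose]
  refine PosSemidef.mul_mul_conjTranspose_same ?_ U
  have : D * D + (2 : ℝ) • D
      = diagonal fun i => hA.eigenvalues i * hA.eigenvalues i + 2 * hA.eigenvalues i := by
    simp only [D, diagonal_mul_diagonal, ← diagonal_smul, diagonal_add]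
    rfl
  rw [this, posSemidef_diagonal_iff]
  exact hd

/-! ### Consequences of girth five -/

namespace SimpleGraph
variable {V : Type*} {G : SimpleGraph V}

theorem not_adj_of_four_le_girth (hg : 4 ≤ G.girth) {x y z : V} (hxy : G.Adj x y)
    (hyz : G.Adj y z) : ¬ G.Adj z x := by
  intro hzx
  have hc : (Walk.cons hxy (.cons hyz (.cons hzx .nil))).IsCycle := by
    have := hxy.ne; have := hyz.ne; have := hzx.ne
    simp [Walk.cons_isCycle_iff, Walk.cons_isPath_iff]
    grind
  have := Walk.IsCircuit.girth_le_length hc.isCircuit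
  simp at this
  omega

theorem eq_of_adj_of_five_le_girth (hg : 5 ≤ G.girth) {x y z w : V} (hxy : G.Adj x y)
    (hyz : G.Adj y z) (hzw : G.Adj z w) (hwx : G.Adj w x) (hxz : x ≠ z) : y = w := by
  by_contra hyw
  have hc : (Walk.cons hxy (.cons hyz (.cons hzw (.cons hwx .nil)))).IsCycle := by
    have := hxy.ne; have := hyz.ne; have := hzw.ne; have := hwx.ne
    simp [Walk.cons_isCycle_iff, Walk.cons_isPath_iff]
    grind
  have := Walk.IsCircuit.girth_le_length hc.isCircuit
  simp at this
  omega

theorem exists_pentagon_of_girth_eq_five (hg : G.girth = 5) :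
    ∃ a b c d e : V, G.Adj a b ∧ G.Adj b c ∧ G.Adj c d ∧ G.Adj d e ∧ G.Adj e a ∧
      [a, b, c, d, e].Nodup := by
  have hna : ¬ G.IsAcyclic := fun h => by simp [girth_eq_zero.2 h] at hg
  obtain ⟨a, w, hw, hl⟩ := exists_girth_eq_length.2 hna
  rw [hg] at hl
  cases w with
  | nil => simp at hl
  | cons h1 w => cases w with
  | nil => simp at hl
  | cons h2 w => cases w with
  | nil => simp at hl
  | cons h3 w => cases w with
  | nil => simp at hl
  | cons h4 w => cases w with
  | nil => simp at hl
  | cons h5 w => cases w with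
  | nil =>
    refine ⟨_, _, _, _, _, h1, h2, h3, h4, h5, ?_⟩
    have := hw.support_nodup
    simp at this ⊢
    grind
  | cons h6 w => simp at hl

end SimpleGraph

/-! ### Cubic graphs with the spectral gap -/

namespace SimpleGraph
variable {V : Type*}

/-- A cubic graph without cycles of length `3` or `4` and without adjacency eigenvalues in
`(-2, 0)`, the last property in the form that `A ^ 2 + 2 A` is positive semidefinite. -/
structure IsGapCubic [Fintype V] [DecidableEq V] (G : SimpleGraph V) [DecidableRel G.Adj] :
    Prop where
  regular : G.IsRegularOfDegree 3
  triangle : ∀ {x y z : V}, G.Adj x y → G.Adj y z → ¬ G.Adj z x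
  square : ∀ {x y z w : V}, G.Adj x y → G.Adj y z → G.Adj z w → G.Adj w x → x ≠ z → y = w
  posSemidef : (G.adjMatrix ℝ * G.adjMatrix ℝ + (2 : ℝ) • G.adjMatrix ℝ).PosSemidef

/-- `u` and `v` are joined by a walk of length `3`. -/
def ThreeWalk (G : SimpleGraph V) (u v : V) : Prop :=
  ∃ s t, G.Adj u s ∧ G.Adj s t ∧ G.Adj t v

theorem ThreeWalk.symm {G : SimpleGraph V} {u v : V} (h : G.ThreeWalk u v) : G.ThreeWalk v u := by
  obtain ⟨s, t, h1, h2, h3⟩ := h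
  exact ⟨t, s, h3.symm, h2.symm, h1.symm⟩

theorem ThreeWalk.of_adj {G : SimpleGraph V} {u v : V} (h : G.Adj u v) : G.ThreeWalk u v :=
  ⟨v, u, h, h.symm, h⟩

/-- `x`, `y`, `z` are distinct and are the neighbours of `u`. -/
structure IsNbrTriple (G : SimpleGraph V) (u x y z : V) : Prop where
  adj_iff : ∀ t, G.Adj u t ↔ t = x ∨ t = y ∨ t = z
  ne₁₂ : x ≠ y
  ne₁₃ : x ≠ z
  ne₂₃ : y ≠ z

namespace IsGapCubic
variable [Fintype V] [DecidableEq V] {G : SimpleGraph V} [DecidableRel G.Adj]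

theorem exists_isNbrTriple_of_adj_adj (hG : G.IsRegularOfDegree 3) {u x y : V} (hx : G.Adj u x)
    (hy : G.Adj u y) (hxy : x ≠ y) : ∃ z, G.IsNbrTriple u x y z := by
  have h1 : (G.neighborFinset u).card = 3 := hG u
  have hxm : x ∈ G.neighborFinset u := by simpa using hx
  have hym : y ∈ (G.neighborFinset u).erase x := by simpa using ⟨hxy.symm, hy⟩
  have h2 : (((G.neighborFinset u).erase x).erase y).card = 1 := by
    rw [Finset.card_erase_of_mem hym, Finset.card_erase_of_mem hxm, h1]
  obtain ⟨z, hz⟩ := Finset.card_eq_one.1 h2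
  have h3 : ∀ t, t ∈ ((G.neighborFinset u).erase x).erase y ↔ t = z := by simp [hz]
  simp only [Finset.mem_erase, mem_neighborFinset] at h3
  refine ⟨z, fun t => ?_, hxy, ?_, ?_⟩ <;> grind

theorem exists_isNbrTriple_of_adj (hG : G.IsRegularOfDegree 3) {u x : V} (hx : G.Adj u x) :
    ∃ y z, G.IsNbrTriple u x y z := by
  have h1 : (G.neighborFinset u).card = 3 := hG u
  have hxm : x ∈ G.neighborFinset u := by simpa using hx
  have h2 : 0 < ((G.neighborFinset u).erase x).card := by
    rw [Finset.card_erase_of_mem hxm, h1]; norm_num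
  obtain ⟨y, hy⟩ := Finset.card_pos.1 h2
  simp only [Finset.mem_erase, mem_neighborFinset] at hy
  exact ⟨y, exists_isNbrTriple_of_adj_adj hG hx hy.2 hy.1.symm⟩

theorem exists_third (hG : G.IsGapCubic) {u x y : V} (hx : G.Adj u x) (hy : G.Adj u y)
    (hxy : x ≠ y) : ∃ z, G.IsNbrTriple u x y z := exists_isNbrTriple_of_adj_adj hG.regular hx hy hxy

theorem exists_triple (hG : G.IsGapCubic) {u x : V} (hx : G.Adj u x) :
    ∃ y z, G.IsNbrTriple u x y z :=
  exists_isNbrTriple_of_adj hG.regular hx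

end IsGapCubic
end SimpleGraph

/-! ### Powers of the adjacency matrix and the quadratic form -/

namespace SimpleGraph
open Matrix
variable {V : Type*} [Fintype V] [DecidableEq V] {G : SimpleGraph V} [DecidableRel G.Adj]

theorem IsNbrTriple.sum_neighborFinset {u x y z : V} (h : G.IsNbrTriple u x y z) (f : V → ℝ) :
    ∑ t ∈ G.neighborFinset u, f t = f x + f y + f z := by
  have : G.neighborFinset u = {x, y, z} := by
    ext t; simp [h.adj_iff]
  rw [this, Finset.sum_insert (by simp [h.ne₁₂, h.ne₁₃]), Finset.sum_pair h.ne₂₃, add_assoc]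

namespace IsGapCubic

local notation "𝐀" => adjMatrix ℝ G

theorem sq_apply (u v : V) :
    (𝐀 * 𝐀) u v = ((G.neighborFinset u ∩ G.neighborFinset v).card : ℝ) := by
  rw [adjMatrix_mul_apply, ← Finset.filter_mem_eq_inter]
  simp [adj_comm, adjMatrix_apply]

theorem sq_nonneg (u v : V) : 0 ≤ (𝐀 * 𝐀) u v := by
  rw [sq_apply]; positivity

theorem sq_self (hG : G.IsGapCubic) (u : V) : (𝐀 * 𝐀) u u = 3 := by
  have h : (G.neighborFinset u).card = 3 := hG.regular u
  rw [sq_apply, Finset.inter_self, h]; norm_num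

theorem sq_eq_one (hG : G.IsGapCubic) {u v b : V} (huv : u ≠ v) (hu : G.Adj u b) (hv : G.Adj v b) :
    (𝐀 * 𝐀) u v = 1 := by
  rw [sq_apply, Nat.cast_eq_one, Finset.card_eq_one]
  refine ⟨b, ?_⟩
  ext t
  simp only [Finset.mem_inter, mem_neighborFinset, Finset.mem_singleton]
  refine ⟨fun h => hG.square h.1 h.2.symm hv hu.symm huv, fun h => h ▸ ⟨hu, hv⟩⟩

theorem sq_eq_zero_or_one (hG : G.IsGapCubic) {u v : V} (huv : u ≠ v) :
    (𝐀 * 𝐀) u v = 0 ∨ (𝐀 * 𝐀) u v = 1 := by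
  by_cases h : ∃ b, G.Adj u b ∧ G.Adj v b
  · obtain ⟨b, hu, hv⟩ := h
    exact .inr (hG.sq_eq_one huv hu hv)
  · left
    rw [sq_apply, Nat.cast_eq_zero, Finset.card_eq_zero]
    push Not at h
    ext t
    simpa using h t

theorem sum_sq_apply (hG : G.IsGapCubic) (u : V) : ∑ v, (𝐀 * 𝐀) u v = 9 := by
  have h := adjMatrix_mulVec_const_apply_of_regular (α := ℝ) (a := 1) (v := u) hG.regular
  have h2 := adjMatrix_mulVec_const_apply_of_regular (α := ℝ) (a := 3) (v := u) hG.regular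
  have : (𝐀 *ᵥ Function.const V (1:ℝ)) = Function.const V 3 := by
    ext v
    rw [adjMatrix_mulVec_const_apply_of_regular hG.regular]; norm_num
  calc ∑ v, (𝐀 * 𝐀) u v = ((𝐀 * 𝐀) *ᵥ Function.const V (1:ℝ)) u := by
        simp [mulVec, dotProduct]
    _ = 9 := by rw [← mulVec_mulVec, this, h2]; norm_num

theorem cube_ne_zero_iff (u v : V) : (𝐀 * (𝐀 * 𝐀)) u v ≠ 0 ↔ G.ThreeWalk u v := by
  rw [adjMatrix_mul_apply, Ne, Finset.sum_eq_zero_iff_of_nonneg fun _ _ => sq_nonneg _ _]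
  simp only [mem_neighborFinset, sq_apply, Nat.cast_eq_zero, Finset.card_eq_zero, ThreeWalk]
  push Not
  simp [Finset.Nonempty, adj_comm]

theorem not_threeWalk_self (hG : G.IsGapCubic) (u : V) : ¬ G.ThreeWalk u u := by
  rintro ⟨s, t, h1, h2, h3⟩
  exact hG.triangle h1 h2 h3

theorem cube_of_adj (hG : G.IsGapCubic) {u v : V} (h : G.Adj u v) : (𝐀 * (𝐀 * 𝐀)) u v = 5 := by
  obtain ⟨x, y, hu⟩ := hG.exists_triple h
  have hx : G.Adj u x := by simp [hu.adj_iff]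
  have hy : G.Adj u y := by simp [hu.adj_iff]
  rw [adjMatrix_mul_apply, hu.sum_neighborFinset, hG.sq_self,
    hG.sq_eq_one hu.ne₁₂.symm hx.symm h.symm,
    hG.sq_eq_one hu.ne₁₃.symm hy.symm h.symm]
  norm_num

/-- The entries of `𝐀 ^ 3 - 4 𝐀` vanish exactly where there is no walk of length `3`. -/
theorem cube_sub_eq_zero_iff (hG : G.IsGapCubic) (u v : V) :
    (𝐀 * (𝐀 * 𝐀)) u v - 4 * 𝐀 u v = 0 ↔ ¬ G.ThreeWalk u v := by
  by_cases h : G.Adj u v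
  · simp [hG.cube_of_adj h, h, ThreeWalk.of_adj h]; norm_num
  · rw [← cube_ne_zero_iff]; simp [h]

theorem fourth_self (hG : G.IsGapCubic) (u : V) : ((𝐀 * 𝐀) * (𝐀 * 𝐀)) u u = 15 := by
  have hs : ∀ v, (𝐀 * 𝐀) v u = (𝐀 * 𝐀) u v := fun v => by
    rw [sq_apply, sq_apply, Finset.inter_comm]
  rw [Matrix.mul_apply]
  -- Off the diagonal the entries of `𝐀 ^ 2` are `0` or `1`, hence equal to their squares; on it `9
  -- = 3 + 6`. With the row sum `9` the total is `15`.
  have h : ∀ v, (𝐀 * 𝐀) u v * (𝐀 * 𝐀) v u = (𝐀 * 𝐀) u v + if v = u then 6 else 0 := by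
    intro v
    rw [hs]
    by_cases huv : v = u
    · subst huv; rw [hG.sq_self]; norm_num
    · rcases hG.sq_eq_zero_or_one (Ne.symm huv) with h | h <;> simp [h, huv]
  simp_rw [h, Finset.sum_add_distrib, hG.sum_sq_apply]
  simp; norm_num

/-- In the sum of `(𝐀 ^ 2)_{av} (𝐀 ^ 2)_{vc}` the terms `v = a` and `v = c` are `3` each, and every
`v ∈ S` gives `1`. -/
theorem le_fourth (hG : G.IsGapCubic) {a b c : V} (hac : a ≠ c) (ha : G.Adj a b) (hc : G.Adj c b)
    (S : Finset V)
    (hS : ∀ v ∈ S, v ≠ a ∧ v ≠ c ∧ (∃ s, G.Adj a s ∧ G.Adj v s) ∧ ∃ t, G.Adj c t ∧ G.Adj v t) :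
    6 + (S.card : ℝ) ≤ ((𝐀 * 𝐀) * (𝐀 * 𝐀)) a c := by
  rw [Matrix.mul_apply]
  have h1 : ∑ v ∈ insert a (insert c S), (𝐀 * 𝐀) a v * (𝐀 * 𝐀) v c = 6 + S.card := by
    rw [Finset.sum_insert, Finset.sum_insert, Finset.sum_congr rfl (g := fun _ => 1)]
    · rw [hG.sq_self, hG.sq_self, hG.sq_eq_one hac ha hc]; simp; ring
    · intro v hv
      obtain ⟨h1, h2, ⟨s, h3, h4⟩, t, h5, h6⟩ := hS v hv
      rw [hG.sq_eq_one h1.symm h3 h4, hG.sq_eq_one h2 h6 h5]; norm_num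
    · intro h; exact (hS c h).2.1 rfl
    · simp only [Finset.mem_insert, not_or]
      exact ⟨hac, fun h => (hS a h).1 rfl⟩
  rw [← h1]
  exact Finset.sum_le_sum_of_subset_of_nonneg (Finset.subset_univ _)
    fun v _ _ => mul_nonneg (sq_nonneg _ _) (sq_nonneg _ _)

/-- The quadratic form of `(𝐀 + β) (𝐀 ^ 2 + 2 𝐀) (𝐀 + β)` at `e_a - e_c`. -/
theorem form_eq (hG : G.IsGapCubic) {a b c : V} (hac : a ≠ c) (ha : G.Adj a b) (hc : G.Adj c b)
    (β : ℝ) (y x : V → ℝ) (hy : y = Pi.single a 1 - Pi.single c 1) (hx : x = 𝐀 *ᵥ y + β • y) :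
    x ⬝ᵥ ((𝐀 * 𝐀 + (2 : ℝ) • 𝐀) *ᵥ x) =
      2 * (15 - ((𝐀 * 𝐀) * (𝐀 * 𝐀)) a c) - 2 * (2 + 2 * β) * (𝐀 * (𝐀 * 𝐀)) a c
        + 4 * (β ^ 2 + 4 * β) := by
  have hnac : ¬ G.Adj a c := fun h => hG.triangle ha hc.symm h.symm
  have hQ : x ⬝ᵥ ((𝐀 * 𝐀 + (2 : ℝ) • 𝐀) *ᵥ x) = y ⬝ᵥ (((𝐀 * 𝐀) * (𝐀 * 𝐀) +
      (2 + 2 * β) • (𝐀 * (𝐀 * 𝐀)) + (β ^ 2 + 4 * β) • (𝐀 * 𝐀) + (2 * β ^ 2) • 𝐀) *ᵥ y) := by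
    have hx' : x = (𝐀 + β • (1 : Matrix V V ℝ)) *ᵥ y := by
      rw [hx, add_mulVec, smul_mulVec, one_mulVec]
    have hT : (𝐀 + β • (1 : Matrix V V ℝ))ᵀ = 𝐀 + β • (1 : Matrix V V ℝ) := by simp
    rw [hx', mulVec_mulVec, dotProduct_comm, dotProduct_mulVec, dotProduct_comm, ← hT,
      vecMul_transpose, hT, mulVec_mulVec]
    congr 2
    noncomm_ring
    module
  have hm : ∀ Q : Matrix V V ℝ, y ⬝ᵥ (Q *ᵥ y) = Q a a - Q a c - Q c a + Q c c := by
    intro Q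
    rw [hy]
    simp [mulVec_sub, sub_dotProduct]
    ring
  have hs2 : (𝐀 * 𝐀) c a = 1 := hG.sq_eq_one hac.symm hc ha
  have hsymm : ∀ Q : Matrix V V ℝ, Qᵀ = Q → Q c a = Q a c := fun Q h => by
    conv_lhs => rw [← h]
    rfl
  have hs3 : (𝐀 * (𝐀 * 𝐀)) c a = (𝐀 * (𝐀 * 𝐀)) a c := hsymm _ (by simp [Matrix.mul_assoc])
  have hs4 : ((𝐀 * 𝐀) * (𝐀 * 𝐀)) c a = ((𝐀 * 𝐀) * (𝐀 * 𝐀)) a c := hsymm _ (by simp)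
  have h3 : ∀ v, (𝐀 * (𝐀 * 𝐀)) v v = 0 := fun v => by
    by_contra h
    exact hG.not_threeWalk_self v ((cube_ne_zero_iff v v).1 h)
  rw [hQ, hm]
  simp only [Matrix.add_apply, Matrix.smul_apply, smul_eq_mul, hs2, hs3, hs4, h3, hG.fourth_self,
    hG.sq_self,
    hG.sq_eq_one hac ha hc]
  simp [hnac, mt Adj.symm hnac]
  ring

end IsGapCubic
end SimpleGraph

/-! ### Hexagons at a path with at most one pentagon -/

namespace SimpleGraph
open Matrix

/-- `a`, `s`, `q`, `t`, `c` is a walk that avoids `b` at `s` and `t`; together with a path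
`a`, `b`, `c` it forms a hexagon in which `q` is opposite to `b`. -/
structure HexAt {V : Type*} (G : SimpleGraph V) (a b c q s t : V) : Prop where
  adj_as : G.Adj a s
  adj_sq : G.Adj s q
  adj_qt : G.Adj q t
  adj_tc : G.Adj t c
  ne_s : s ≠ b
  ne_t : t ≠ b

variable {V : Type*} [Fintype V] [DecidableEq V] {G : SimpleGraph V} [DecidableRel G.Adj]

namespace IsGapCubic

local notation "𝐀" => adjMatrix ℝ G

/-- The unit beyond `6` comes from the third neighbour `d` of `b`; it is not in `S`, as it would
close a square. -/
theorem le_fourth_of_hexAt (hG : G.IsGapCubic) {a b c : V} (hac : a ≠ c) (ha : G.Adj a b)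
    (hc : G.Adj b c) (S : Finset V) (hS : ∀ q ∈ S, ∃ s t, G.HexAt a b c q s t) :
    7 + (S.card : ℝ) ≤ ((𝐀 * 𝐀) * (𝐀 * 𝐀)) a c := by
  obtain ⟨d, hd⟩ := hG.exists_third ha.symm hc hac
  have hbd : G.Adj b d := by simp [hd.adj_iff]
  have hdS : d ∉ S := fun h => by
    obtain ⟨s, t, h⟩ := hS d h
    exact h.ne_s (hG.square h.adj_as h.adj_sq hbd.symm ha.symm hd.ne₁₃)
  have := hG.le_fourth hac ha hc.symm (insert d S) ?_
  · rw [Finset.card_insert_of_notMem hdS] at this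
    push_cast at this
    linarith
  · intro v hv
    rcases Finset.mem_insert.1 hv with rfl | hv
    · exact ⟨hd.ne₁₃.symm, hd.ne₂₃.symm, ⟨b, ha, hbd.symm⟩, b, hc.symm, hbd.symm⟩
    · obtain ⟨s, t, h⟩ := hS v hv
      refine ⟨?_, ?_, ⟨s, h.adj_as, h.adj_sq.symm⟩, t, h.adj_tc.symm, h.adj_qt⟩
      · rintro rfl
        exact h.ne_t (hG.square h.adj_qt h.adj_tc hc.symm ha.symm hac)
      · rintro rfl
        exact h.ne_s (hG.square h.adj_as h.adj_sq hc.symm ha.symm hac)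

theorem form_nonneg (hG : G.IsGapCubic) (x : V → ℝ) :
    0 ≤ x ⬝ᵥ ((𝐀 * 𝐀 + (2 : ℝ) • 𝐀) *ᵥ x) := by
  simpa using hG.posSemidef.dotProduct_mulVec_nonneg x

theorem cube_eq_zero {a c : V} (h : ¬ G.ThreeWalk a c) : (𝐀 * (𝐀 * 𝐀)) a c = 0 := by
  by_contra h'
  exact h ((cube_ne_zero_iff a c).1 h')

/-- With `T = (𝐀 ^ 3)_{ac}`, the form in `form_eq` is smallest at `β = (T - 4) / 2`. Here `T = 0`
and `β = -2`: the form is `14 - 2 (𝐀 ^ 4)_{ac}`, and a hexagon would make it at most `-2`. -/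
theorem not_hexAt (hG : G.IsGapCubic) {a b c : V} (hac : a ≠ c) (ha : G.Adj a b)
    (hc : G.Adj b c) (h : ¬ G.ThreeWalk a c) (q s t : V) : ¬ G.HexAt a b c q s t := by
  intro hq
  have h1 := hG.le_fourth_of_hexAt hac ha hc {q} (by simpa using ⟨s, t, hq⟩)
  have h2 := hG.form_nonneg (𝐀 *ᵥ (Pi.single a 1 - Pi.single c 1)
    + (-2 : ℝ) • (Pi.single a 1 - Pi.single c 1))
  rw [hG.form_eq hac ha hc.symm (-2) _ _ rfl rfl, cube_eq_zero h] at h2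
  norm_num at h1 h2
  linarith

/-- Now `(𝐀 ^ 4)_{ac} ≥ 7` makes the form `14 - 2 (𝐀 ^ 4)_{ac}` vanish, so by semidefiniteness `x`
is in the kernel of `𝐀 ^ 2 + 2 𝐀`. Since `(𝐀 ^ 2 + 2 𝐀) (𝐀 - 2) = 𝐀 ^ 3 - 4 𝐀`, the columns of the
latter at `a` and `c` agree, in particular their zeros. -/
theorem threeWalk_congr (hG : G.IsGapCubic) {a b c : V} (hac : a ≠ c) (ha : G.Adj a b)
    (hc : G.Adj b c) (h : ¬ G.ThreeWalk a c) (v : V) : G.ThreeWalk a v ↔ G.ThreeWalk c v := by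
  have h1 := hG.le_fourth_of_hexAt hac ha hc ∅ (by simp)
  set y : V → ℝ := Pi.single a 1 - Pi.single c 1 with hy
  set x : V → ℝ := 𝐀 *ᵥ y + (-2 : ℝ) • y with hx
  have h2 := hG.form_nonneg x
  have h3 := hG.form_eq hac ha hc.symm (-2) _ _ hy hx
  rw [cube_eq_zero h] at h3
  have h4 : x ⬝ᵥ ((𝐀 * 𝐀 + (2 : ℝ) • 𝐀) *ᵥ x) = 0 := by
    refine le_antisymm ?_ h2
    rw [h3]
    norm_num at h1 ⊢
    linarith
  have h5 : (𝐀 * 𝐀 + (2 : ℝ) • 𝐀) *ᵥ x = 0 := by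
    have := hG.posSemidef.dotProduct_mulVec_zero_iff x
    simpa using this.1 (by simpa using h4)
  have h6 : (𝐀 * (𝐀 * 𝐀) - (4 : ℝ) • 𝐀) *ᵥ y = 0 := by
    rw [← h5]
    have hx' : x = (𝐀 + (-2 : ℝ) • (1 : Matrix V V ℝ)) *ᵥ y := by
      rw [hx, add_mulVec, smul_mulVec, one_mulVec]
    rw [hx', mulVec_mulVec]
    congr 1
    noncomm_ring
    module
  have h7 := congrFun h6 v
  rw [hy, mulVec_sub, mulVec_single_one, mulVec_single_one] at h7
  simp only [Pi.sub_apply, Matrix.col_apply, Matrix.sub_apply, Matrix.smul_apply, smul_eq_mul,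
    Pi.zero_apply] at h7
  have h8 : ¬ G.ThreeWalk v a ↔ ¬ G.ThreeWalk v c := by
    rw [← hG.cube_sub_eq_zero_iff, ← hG.cube_sub_eq_zero_iff, sub_eq_zero.1 h7]
  have hs : ∀ u w, G.ThreeWalk u w ↔ G.ThreeWalk w u := fun u w => ⟨.symm, .symm⟩
  rw [hs a, hs c]
  exact not_iff_not.1 h8

/-- Only the pentagon through `a₁`, `c₁` remains at the path, because an edge from `a₂` to `c₁`
would close a square; hence `(𝐀 ^ 3)_{ac} ≤ 1`. At `β = -3/2`, optimal for the value `1`, the form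
is `15 + 2 (𝐀 ^ 3)_{ac} - 2 (𝐀 ^ 4)_{ac}`, whereas two opposite vertices require `(𝐀 ^ 4)_{ac} ≥ 9`.
-/
theorem hexAt_unique (hG : G.IsGapCubic) {a b c a₁ a₂ c₁ c₂ : V} (hac : a ≠ c)
    (ha : G.IsNbrTriple a b a₁ a₂) (hc : G.IsNbrTriple c b c₁ c₂) (h₁ : G.Adj a₁ c₁)
    (h₂ : ¬ G.Adj a₂ c₂) {q s t q' s' t' : V} (hq : G.HexAt a b c q s t)
    (hq' : G.HexAt a b c q' s' t') : q = q' := by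
  by_contra hne
  have hab : G.Adj a b := by simp [ha.adj_iff]
  have hcb : G.Adj c b := by simp [hc.adj_iff]
  have haa₁ : G.Adj a a₁ := by simp [ha.adj_iff]
  have haa₂ : G.Adj a a₂ := by simp [ha.adj_iff]
  have hcc₁ : G.Adj c c₁ := by simp [hc.adj_iff]
  have hcc₂ : G.Adj c c₂ := by simp [hc.adj_iff]
  have hbc : (𝐀 * 𝐀) b c = 0 := by
    rw [sq_apply, Nat.cast_eq_zero, Finset.card_eq_zero]
    ext t
    simp only [Finset.mem_inter, mem_neighborFinset, Finset.notMem_empty, iff_false, not_and]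
    exact fun h1 h2 => hG.triangle h1 h2.symm hcb
  have h1c : (𝐀 * 𝐀) a₁ c ≤ 1 := by
    rcases eq_or_ne a₁ c with rfl | h
    · exact absurd hab (hG.triangle hcb.symm haa₁.symm)
    · exact (hG.sq_eq_zero_or_one h).elim (fun h => by simp [h]) (fun h => by simp [h])
  have h2c : (𝐀 * 𝐀) a₂ c = 0 := by
    rw [sq_apply, Nat.cast_eq_zero, Finset.card_eq_zero]
    ext t
    simp only [Finset.mem_inter, mem_neighborFinset, Finset.notMem_empty, iff_false, not_and]
    rw [hc.adj_iff]
    rintro h (rfl | rfl | rfl)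
    · exact hG.triangle haa₂ h hab.symm
    · refine ha.ne₂₃ (hG.square haa₁ h₁ h.symm haa₂.symm ?_)
      rintro rfl
      exact hG.triangle hab hcb.symm hcc₁
    · exact h₂ h
  have h3 : (𝐀 * (𝐀 * 𝐀)) a c ≤ 1 := by
    rw [adjMatrix_mul_apply, ha.sum_neighborFinset, hbc, h2c]
    linarith
  have h1 := hG.le_fourth_of_hexAt hac hab hcb.symm {q, q'} (by
    simpa using ⟨⟨s, t, hq⟩, s', t', hq'⟩)
  rw [Finset.card_pair hne] at h1
  have h2 := hG.form_nonneg (𝐀 *ᵥ (Pi.single a 1 - Pi.single c 1)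
    + (-3 / 2 : ℝ) • (Pi.single a 1 - Pi.single c 1))
  rw [hG.form_eq hac hab hcb (-3 / 2) _ _ rfl rfl] at h2
  norm_num at h1
  linarith

end IsGapCubic
end SimpleGraph

/-! ### Every path on three vertices lies on a pentagon -/

namespace SimpleGraph
variable {V : Type*}

theorem Connected.forall_of_adj {G : SimpleGraph V} (hc : G.Connected) {p : V → Prop}
    (hp : ∀ u v, G.Adj u v → p u → p v) {u : V} (hu : p u) (v : V) : p v := by
  obtain ⟨w⟩ := hc.preconnected u v
  induction w with
  | nil => exact hu
  | cons h _ ih => exact ih (hp _ _ h hu)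

/-- `a`, `b`, `c` is a path that is not contained in a pentagon. -/
structure OpenAngle (G : SimpleGraph V) (a b c : V) : Prop where
  adj_left : G.Adj a b
  adj_right : G.Adj b c
  ne : a ≠ c
  not_threeWalk : ¬ G.ThreeWalk a c

theorem OpenAngle.symm {G : SimpleGraph V} {a b c : V} (h : G.OpenAngle a b c) :
    G.OpenAngle c b a :=
  ⟨h.adj_right.symm, h.adj_left.symm, h.ne.symm, fun h' => h.not_threeWalk h'.symm⟩

/-- `b` lies on a pentagon. -/
def OnPentagon (G : SimpleGraph V) (b : V) : Prop :=
  ∃ u w, u ≠ w ∧ G.Adj b u ∧ G.Adj b w ∧ G.ThreeWalk u w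

variable [Fintype V] [DecidableEq V] {G : SimpleGraph V} [DecidableRel G.Adj]

namespace IsGapCubic

theorem congr_of_openAngle (hG : G.IsGapCubic) {a b c : V} (h : G.OpenAngle a b c) (v : V) :
    G.ThreeWalk a v ↔ G.ThreeWalk c v :=
  hG.threeWalk_congr h.ne h.adj_left h.adj_right h.not_threeWalk v

theorem not_hexAt_of_openAngle (hG : G.IsGapCubic) {a b c : V} (h : G.OpenAngle a b c) {q s t : V}
    (h₁ : G.Adj a s) (h₂ : G.Adj s q) (h₃ : G.Adj q t) (h₄ : G.Adj t c) (hs : s ≠ b)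
    (ht : t ≠ b) : False :=
  hG.not_hexAt h.ne h.adj_left h.adj_right h.not_threeWalk q s t ⟨h₁, h₂, h₃, h₄, hs, ht⟩

/-- Let the pentagon at `a` use the neighbours `u`, `w`. If it misses `b` and `b` is on no pentagon,
then `u`, `a`, `b` is open, and the congruence carries the 3-walk from `u` to `w` over to `b`, which
puts `b` on a pentagon after all. -/
theorem onPentagon_of_adj (hG : G.IsGapCubic) {a b : V} (hab : G.Adj a b) (ha : G.OnPentagon a) :
    G.OnPentagon b := by
  have key : ∀ w, G.Adj a w → w ≠ b → G.ThreeWalk b w → G.OnPentagon b := by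
    rintro w haw hwb ⟨x, y, h1, h2, h3⟩
    refine ⟨x, a, ?_, h1, hab.symm, y, w, h2, h3, haw.symm⟩
    rintro rfl
    exact hG.triangle h2 h3 haw.symm
  obtain ⟨u, w, huw, hu, hw, h⟩ := ha
  rcases eq_or_ne u b with rfl | hub
  · exact key w hw huw.symm h
  rcases eq_or_ne w b with rfl | hwb
  · exact key u hu hub h.symm
  by_contra hb
  have hbw : ¬ G.ThreeWalk b w := fun h => hb (key w hw hwb h)
  have hub' : ¬ G.ThreeWalk u b := fun h => hb (key u hu hub h.symm)
  exact hbw ((hG.congr_of_openAngle ⟨hu.symm, hab, hub, hub'⟩ w).1 h)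

/-- The two pentagons at the middle vertex of a path that is not contained in a pentagon. -/
theorem exists_pentagons_of_openAngle (hG : G.IsGapCubic) (hp : ∀ v, G.OnPentagon v)
    {a b c d : V} (h : G.OpenAngle a b c) (hb : G.IsNbrTriple b a c d) :
    ∃ a₁ d₁ d₂ c₁, G.Adj a a₁ ∧ G.Adj a₁ d₁ ∧ G.Adj d₁ d ∧ G.Adj d d₂ ∧ G.Adj d₂ c₁ ∧
      G.Adj c₁ c ∧ a₁ ≠ b ∧ c₁ ≠ b ∧ d₁ ≠ b ∧ d₂ ≠ b ∧ d₁ ≠ d₂ := by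
  have hcongr := hG.congr_of_openAngle h
  have hT : G.ThreeWalk a d := by
    -- The pentagon at `b` cannot use both `a` and `c`, so it uses `d` and one of them; the
    -- congruence gives a 3-walk to `d` from both.
    obtain ⟨u, w, huw, hu, hw, h'⟩ := hp b
    rw [hb.adj_iff] at hu hw
    have h1 := hcongr d
    have h2 := h.not_threeWalk
    have h3 := h'.symm
    have h4 : ¬ G.ThreeWalk c a := h.symm.not_threeWalk
    rcases hu with rfl | rfl | rfl <;> rcases hw with rfl | rfl | rfl <;> tauto
  have hT' := (hcongr d).1 hT
  have hbd : G.Adj b d := by simp [hb.adj_iff]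
  obtain ⟨a₁, d₁, h1, h2, h3⟩ := hT
  obtain ⟨c₁, d₂, h4, h5, h6⟩ := hT'
  have hab := h.adj_left
  have hbc := h.adj_right
  have ha₁ : a₁ ≠ b := by
    rintro rfl; exact hG.triangle h2 h3 hbd.symm
  have hc₁ : c₁ ≠ b := by
    rintro rfl; exact hG.triangle h5 h6 hbd.symm
  refine ⟨a₁, d₁, d₂, c₁, h1, h2, h3, h6.symm, h5.symm, h4.symm, ha₁, hc₁, ?_, ?_, ?_⟩
  · rintro rfl; exact hG.triangle h1 h2 hab.symm
  · rintro rfl; exact hG.triangle h4 h5 hbc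
  -- If `d₁ = d₂`, this vertex is opposite to `b` in a hexagon at the open path.
  · rintro rfl
    exact hG.not_hexAt_of_openAngle h h1 h2 h5.symm h4.symm ha₁ hc₁

/-- Take for `a₂` the neighbour of `a` off the pentagon through `a`, `b`, `d`. A pentagon at `a₂`,
`a`, `b` leaves `b` through `c`, contradicting openness, or through `d`, giving a triangle, a square
or a hexagon at the open path. -/
theorem exists_openAngle (hG : G.IsGapCubic) (hp : ∀ v, G.OnPentagon v)
    {a b c : V} (h : G.OpenAngle a b c) : ∃ a₂, G.OpenAngle a₂ a b := by
  obtain ⟨d, hb⟩ := hG.exists_third h.adj_left.symm h.adj_right h.ne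
  obtain ⟨a₁, d₁, d₂, c₁, h1, h2, h3, h4, h5, h6, n1, n2, n3, n4, n5⟩ :=
    hG.exists_pentagons_of_openAngle hp h hb
  have hab := h.adj_left
  have hbd : G.Adj b d := by simp [hb.adj_iff]
  obtain ⟨a₂, ha⟩ := hG.exists_third h1 hab n1
  have haa₂ : G.Adj a a₂ := by simp [ha.adj_iff]
  refine ⟨a₂, haa₂.symm, hab, ha.ne₂₃.symm, ?_⟩
  rintro ⟨y, x, g1, g2, g3⟩
  rcases (hb.adj_iff x).1 g3.symm with rfl | rfl | rfl
  · exact hG.triangle g1 g2 haa₂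
  · exact h.not_threeWalk ⟨a₂, y, haa₂, g1, g2⟩
  · obtain ⟨z, hd⟩ := hG.exists_third h3.symm h4 n5
    have : b = z := by
      have := (hd.adj_iff b).1 hbd.symm
      tauto
    subst this
    rcases (hd.adj_iff y).1 g2.symm with rfl | rfl | rfl
    · refine ha.ne₁₃ (hG.square h1 h2 g1.symm haa₂.symm ?_)
      rintro rfl
      exact hG.triangle h3 hbd.symm hab.symm
    · exact hG.not_hexAt_of_openAngle h haa₂ g1 h5 h6 ha.ne₂₃.symm n2
    · exact hG.triangle g1 hab.symm haa₂

/-- Five edges with four consecutive open angles leave no room. The congruence forces a 3-walk from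
`v₀` to `w₃`, the third neighbour of `v₃`; each possible course of it yields a forbidden 3-walk, a
hexagon at an open angle or a vertex of degree four. -/
theorem not_openAngle (hG : G.IsGapCubic) (hp : ∀ v, G.OnPentagon v) (a b c : V) :
    ¬ G.OpenAngle a b c := by
  intro h
  -- the path `u`, `v₀`, `v₁`, `v₂`, `v₃`, `v₄` extends `a`, `b`, `c`
  obtain ⟨v₀, h012⟩ : ∃ v₀, G.OpenAngle v₀ a b := hG.exists_openAngle hp h
  obtain ⟨u, h_01⟩ : ∃ u, G.OpenAngle u v₀ a := hG.exists_openAngle hp h012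
  obtain ⟨v₄, h432⟩ : ∃ v₄, G.OpenAngle v₄ c b := hG.exists_openAngle hp h.symm
  rename' a => v₁, b => v₂, c => v₃
  have h123 := h
  have h234 := h432.symm
  obtain ⟨w₀, hv₀⟩ := hG.exists_third h_01.adj_left.symm h_01.adj_right h_01.ne
  obtain ⟨w₃, hv₃⟩ := hG.exists_third h234.adj_left.symm h234.adj_right h234.ne
  obtain ⟨w, z, z₀, w₁, p1, p2, p3, p4, p5, p6, p7, p8, p9, p10, p11⟩ :=
    hG.exists_pentagons_of_openAngle hp h_01 hv₀
  obtain ⟨w₂, z₂, z₃, w₄, q1, q2, q3, q4, q5, q6, q7, q8, q9, q10, q11⟩ :=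
    hG.exists_pentagons_of_openAngle hp h234 hv₃
  have a_0 := h_01.adj_left
  have a01 := h_01.adj_right
  have a12 := h123.adj_left
  have a23 := h123.adj_right
  have a34 := h234.adj_right
  have aw₀ : G.Adj v₀ w₀ := by simp [hv₀.adj_iff]
  have aw₃ : G.Adj v₃ w₃ := by simp [hv₃.adj_iff]
  have hT : G.ThreeWalk v₀ w₃ := by
    rw [hG.congr_of_openAngle h012]
    exact ⟨w₂, z₂, q1, q2, q3⟩
  obtain ⟨x, y, g1, g2, g3⟩ := hT
  have n02 : ¬ G.ThreeWalk v₀ v₂ := h012.not_threeWalk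
  have n13 : ¬ G.ThreeWalk v₁ v₃ := h123.not_threeWalk
  have n_1 : ¬ G.ThreeWalk v₁ u := h_01.symm.not_threeWalk
  have n_3 : ¬ G.ThreeWalk v₃ u := by rwa [← hG.congr_of_openAngle h123]
  have n24 : ¬ G.ThreeWalk v₂ v₄ := h234.not_threeWalk
  have n04 : ¬ G.ThreeWalk v₀ v₄ := by rwa [hG.congr_of_openAngle h012]
  rcases (hv₀.adj_iff x).1 g1 with rfl | rfl | rfl
  · exact n_3 ⟨w₃, y, aw₃, g3.symm, g2.symm⟩
  · exact n13 ⟨y, w₃, g2, g3, aw₃.symm⟩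
  obtain ⟨t, hw₃⟩ := hG.exists_third q3.symm q4 q11
  have : v₃ = t := by
    have := (hw₃.adj_iff v₃).1 aw₃.symm
    tauto
  subst this
  obtain ⟨t, hw₀⟩ := hG.exists_third p3.symm p4 p11
  have : v₀ = t := by
    have := (hw₀.adj_iff v₀).1 aw₀.symm
    tauto
  subst this
  rcases (hw₃.adj_iff y).1 g3.symm with rfl | rfl | rfl
  · refine hG.not_hexAt_of_openAngle h012 aw₀ g2 q2.symm q1.symm hv₀.ne₂₃.symm ?_
    rintro rfl
    exact n13 ⟨_, _, q2, q3, aw₃.symm⟩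
  · rcases (hw₀.adj_iff y).1 g2 with rfl | rfl | rfl
    -- Here `y` lies on both pentagon systems and would have the four distinct neighbours `w`, `x`,
    -- `w₃`, `w₄`.
    · have h1 : w ≠ x := by rintro rfl; exact n_1 ⟨v₀, w, a01.symm, aw₀, p1.symm⟩
      have h2 : w₃ ≠ w₄ := by rintro rfl; exact hG.triangle aw₃ q6 a34.symm
      have h3 : x ≠ w₃ := by rintro rfl; exact n02 ⟨x, v₃, aw₀, aw₃.symm, a23.symm⟩
      have h4 : w ≠ w₃ := by
        rintro rfl
        exact hG.not_hexAt_of_openAngle h012 a_0.symm p1 aw₃.symm a23.symm h_01.ne h123.ne.symm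
      have h5 : x ≠ w₄ := by
        rintro rfl
        exact hG.not_hexAt_of_openAngle h123 a01.symm aw₀ q6 a34.symm h012.ne h234.ne.symm
      have h6 : w ≠ w₄ := by
        rintro rfl
        exact n04 ⟨u, w, a_0.symm, p1, q6⟩
      obtain ⟨t, hy⟩ := hG.exists_third g3 q5 h2
      have := (hy.adj_iff w).1 p2.symm
      have := (hy.adj_iff x).1 g2.symm
      grind
    · refine hG.not_hexAt_of_openAngle h123 p6.symm p5.symm g3 aw₃.symm ?_ hv₃.ne₁₃.symm
      rintro rfl
      exact n02 ⟨x, y, aw₀, g2, p5⟩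
    · exact n02 ⟨_, v₃, g3, aw₃.symm, a23.symm⟩
  · exact n02 ⟨x, y, aw₀, g2, a23.symm⟩

end IsGapCubic
end SimpleGraph

/-! ### The model graphs and their short walks -/

/-- The adjacency relation of `generalizedPetersenGraph n k` as a Boolean function. -/
def generalizedPetersenAdj (n k : ℕ) : ZMod n ⊕ ZMod n → ZMod n ⊕ ZMod n → Bool
  | .inl i, .inl j => j == i + 1 || i == j + 1
  | .inl i, .inr j => j == i
  | .inr i, .inl j => j == i
  | .inr i, .inr j => j == i + (k : ZMod n) || i == j + (k : ZMod n)

theorem generalizedPetersenGraph_adj_iff {n k : ℕ} (h1 : (1 : ZMod n) ≠ 0) (hk : (k : ZMod n) ≠ 0)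
    (x y : ZMod n ⊕ ZMod n) :
    (generalizedPetersenGraph n k).Adj x y ↔ generalizedPetersenAdj n k x y = true := by
  have h : ∀ (i j c : ZMod n), c ≠ 0 → (j = i + c ∨ i = j + c) → i ≠ j := by
    rintro i j c hc (h | h) rfl <;> simp at h <;> exact hc h
  rcases x with i | i <;> rcases y with j | j <;>
    simp only [generalizedPetersenGraph, generalizedPetersenAdj, SimpleGraph.fromRel_adj,
      Bool.or_eq_true, beq_iff_eq, ne_eq, Sum.inl.injEq, Sum.inr.injEq, reduceCtorEq,
      not_false_eq_true, true_and, or_false, false_or]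
  · have := h i j 1 h1
    grind
  · exact eq_comm
  · have := h i j k hk
    grind

theorem petersenGraph_adj_iff (x y : ZMod 5 ⊕ ZMod 5) :
    petersenGraph.Adj x y ↔ generalizedPetersenAdj 5 2 x y = true :=
  generalizedPetersenGraph_adj_iff (by decide) (by decide) x y

theorem dodecahedronGraph_adj_iff (x y : ZMod 10 ⊕ ZMod 10) :
    dodecahedronGraph.Adj x y ↔ generalizedPetersenAdj 10 2 x y = true :=
  generalizedPetersenGraph_adj_iff (by decide) (by decide) x y

/-- The three neighbours of a vertex of `generalizedPetersenGraph n k`. -/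
def generalizedPetersenNbr (n k : ℕ) : ZMod n ⊕ ZMod n → List (ZMod n ⊕ ZMod n)
  | .inl i => [.inr i, .inl (i + 1), .inl (i - 1)]
  | .inr i => [.inl i, .inr (i + k), .inr (i - k)]

theorem generalizedPetersenAdj_of_mem {n k : ℕ} {x y : ZMod n ⊕ ZMod n}
    (h : y ∈ generalizedPetersenNbr n k x) : generalizedPetersenAdj n k x y = true := by
  rcases x with i | i <;> simp [generalizedPetersenNbr] at h <;>
    rcases h with rfl | rfl | rfl <;> simp [generalizedPetersenAdj]

/-- Under a homomorphism a collision of `s` and `t` would turn such an edge or 3-walk into a loop or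
a triangle. -/
theorem petersenGraph_walk : ∀ s t : ZMod 5 ⊕ ZMod 5, s = t ∨ generalizedPetersenAdj 5 2 s t ∨
    ∃ x ∈ generalizedPetersenNbr 5 2 s, ∃ y ∈ generalizedPetersenNbr 5 2 x,
      generalizedPetersenAdj 5 2 y t := by
  decide +kernel

/-- This gives local injectivity: if two neighbours of `s` had the same image, the 3-walk between
them would map to a triangle. -/
theorem dodecahedronGraph_walk_of_adj : ∀ s : ZMod 10 ⊕ ZMod 10,
    ∀ x ∈ generalizedPetersenNbr 10 2 s, ∀ y ∈ generalizedPetersenNbr 10 2 s, x = y ∨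
    ∃ z ∈ generalizedPetersenNbr 10 2 x, ∃ w ∈ generalizedPetersenNbr 10 2 z,
      generalizedPetersenAdj 10 2 w y := by
  decide +kernel

-- Each alternative refutes a collision of `s` and `t`: a loop, a triangle, a square, or, in the
-- last one, two pentagons on the images of `s`, `x`, `y` that continue to `z` and to `m`. One
-- vertex `s` from each rotation orbit is enough.
set_option synthInstance.maxHeartbeats 400000 in
set_option synthInstance.maxSize 1000 in
theorem dodecahedronGraph_walk : ∀ b : Bool, ∀ t : ZMod 10 ⊕ ZMod 10,
    let s : ZMod 10 ⊕ ZMod 10 := if b then .inl 0 else .inr 0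
    s = t ∨
    generalizedPetersenAdj 10 2 s t ∨ ∃ x ∈ generalizedPetersenNbr 10 2 s,
    ∃ y ∈ generalizedPetersenNbr 10 2 x, generalizedPetersenAdj 10 2 y t ∨
    ∃ z ∈ generalizedPetersenNbr 10 2 y, s ≠ y ∧ x ≠ z ∧ (generalizedPetersenAdj 10 2 z t ∨
    ∃ w ∈ generalizedPetersenNbr 10 2 z, generalizedPetersenAdj 10 2 w t ∧
    ∃ m ∈ generalizedPetersenNbr 10 2 y, z ≠ m ∧ ∃ n ∈ generalizedPetersenNbr 10 2 m,
      generalizedPetersenAdj 10 2 n s) := by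
  decide +kernel

/-! ### Homomorphisms from the model graphs are isomorphisms -/

namespace SimpleGraph
variable {V : Type*} [Fintype V] [DecidableEq V] {G : SimpleGraph V} [DecidableRel G.Adj]

namespace IsGapCubic

/-- An injective homomorphism from a graph of minimum degree at least `3` to a connected cubic
graph is an isomorphism. -/
theorem nonempty_iso_of_injective (hG : G.IsGapCubic) (hconn : G.Connected) {W : Type*}
    [Nonempty W] {H : SimpleGraph W} (f : W → V) (hf : f.Injective)
    (hadj : ∀ x y, H.Adj x y → G.Adj (f x) (f y))
    (hdeg : ∀ s, ∃ x y z, H.Adj s x ∧ H.Adj s y ∧ H.Adj s z ∧ x ≠ y ∧ x ≠ z ∧ y ≠ z) :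
    Nonempty (G ≃g H) := by
  have key : ∀ s v, G.Adj (f s) v → ∃ t, f t = v ∧ H.Adj s t := by
    intro s v hv
    obtain ⟨x, y, z, hx, hy, hz, hxy, hxz, hyz⟩ := hdeg s
    obtain ⟨z', h⟩ := hG.exists_third (hadj _ _ hx) (hadj _ _ hy) (hf.ne hxy)
    have hz' : f z = z' := by
      have := (h.adj_iff (f z)).1 (hadj _ _ hz)
      have := hf.ne hxz
      have := hf.ne hyz
      grind
    rcases (h.adj_iff v).1 hv with rfl | rfl | rfl
    exacts [⟨x, rfl, hx⟩, ⟨y, rfl, hy⟩, ⟨z, hz', hz⟩]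
  have hsurj : f.Surjective := by
    obtain ⟨s⟩ := ‹Nonempty W›
    refine fun v => hconn.forall_of_adj (p := fun v => ∃ s, f s = v) ?_ ⟨s, rfl⟩ v
    rintro u v huv ⟨s, rfl⟩
    obtain ⟨t, ht, -⟩ := key s v huv
    exact ⟨t, ht⟩
  refine ⟨Iso.symm ⟨Equiv.ofBijective f ⟨hf, hsurj⟩, ?_⟩⟩
  intro x y
  refine ⟨fun h => ?_, hadj x y⟩
  obtain ⟨t, ht, ht'⟩ := key x _ h
  exact hf ht ▸ ht'

theorem adj_of_hom {V : Type*} {G : SimpleGraph V} {n k : ℕ} {f : ZMod n ⊕ ZMod n → V}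
    (h₁ : ∀ i, G.Adj (f (.inl i)) (f (.inl (i + 1)))) (h₂ : ∀ i, G.Adj (f (.inl i)) (f (.inr i)))
    (h₃ : ∀ i, G.Adj (f (.inr i)) (f (.inr (i + k)))) (x y : ZMod n ⊕ ZMod n)
    (h : generalizedPetersenAdj n k x y = true) : G.Adj (f x) (f y) := by
  rcases x with i | i <;> rcases y with j | j <;> simp [generalizedPetersenAdj] at h
  · rcases h with rfl | rfl
    exacts [h₁ i, (h₁ j).symm]
  · exact h ▸ h₂ i
  · exact h ▸ (h₂ i).symm
  · rcases h with rfl | rfl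
    exacts [h₃ i, (h₃ j).symm]

theorem exists_three_adj {n k : ℕ} {H : SimpleGraph (ZMod n ⊕ ZMod n)}
    (hH : ∀ x y, H.Adj x y ↔ generalizedPetersenAdj n k x y = true)
    (h₁ : ∀ i : ZMod n, i + 1 ≠ i - 1) (hk : ∀ i : ZMod n, i + k ≠ i - k)
    (s : ZMod n ⊕ ZMod n) :
    ∃ x y z, H.Adj s x ∧ H.Adj s y ∧ H.Adj s z ∧ x ≠ y ∧ x ≠ z ∧ y ≠ z := by
  simp only [hH]
  rcases s with i | i
  · exact ⟨.inr i, .inl (i + 1), .inl (i - 1), by simp [generalizedPetersenAdj],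
      by simp [generalizedPetersenAdj], by simp [generalizedPetersenAdj], by simp, by simp,
      by simpa using h₁ i⟩
  · exact ⟨.inl i, .inr (i + k), .inr (i - k), by simp [generalizedPetersenAdj],
      by simp [generalizedPetersenAdj], by simp [generalizedPetersenAdj], by simp, by simp,
      by simpa using hk i⟩

theorem nonempty_iso_petersenGraph (hG : G.IsGapCubic) (hconn : G.Connected)
    (f : ZMod 5 ⊕ ZMod 5 → V)
    (h₁ : ∀ i, G.Adj (f (.inl i)) (f (.inl (i + 1)))) (h₂ : ∀ i, G.Adj (f (.inl i)) (f (.inr i)))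
    (h₃ : ∀ i, G.Adj (f (.inr i)) (f (.inr (i + 2)))) : Nonempty (G ≃g petersenGraph) := by
  have hadj := adj_of_hom (n := 5) (k := 2) h₁ h₂ h₃
  have hmem := fun x y (h : y ∈ generalizedPetersenNbr 5 2 x) =>
    hadj x y (generalizedPetersenAdj_of_mem h)
  refine hG.nonempty_iso_of_injective hconn f ?_
    (fun x y h => hadj x y ((petersenGraph_adj_iff x y).1 h)) fun s =>
      exists_three_adj (petersenGraph_adj_iff) (by decide) (by decide) s
  intro s t hst
  rcases petersenGraph_walk s t with h | h | ⟨x, hx, y, hy, h⟩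
  · exact h
  · exact absurd (hst ▸ hadj _ _ h) (G.irrefl)
  · exact absurd (hst ▸ hadj _ _ h) (hG.triangle (hmem _ _ hx) (hmem _ _ hy))

theorem injective_of_dodecahedron_hom (hG : G.IsGapCubic)
    (hu : ∀ {a b c s t s' t'}, G.Adj a b → G.Adj b c → a ≠ c → G.Adj a s → G.Adj s t → G.Adj t c →
      G.Adj a s' → G.Adj s' t' → G.Adj t' c → t = t')
    (f : ZMod 10 ⊕ ZMod 10 → V)
    (h₁ : ∀ i, G.Adj (f (.inl i)) (f (.inl (i + 1)))) (h₂ : ∀ i, G.Adj (f (.inl i)) (f (.inr i)))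
    (h₃ : ∀ i, G.Adj (f (.inr i)) (f (.inr (i + 2)))) (b : Bool) (t : ZMod 10 ⊕ ZMod 10)
    (hst : f (if b then .inl 0 else .inr 0) = f t) : (if b then .inl 0 else .inr 0) = t := by
  have hadj := adj_of_hom (n := 10) (k := 2) h₁ h₂ h₃
  have hmem := fun x y (h : y ∈ generalizedPetersenNbr 10 2 x) =>
    hadj x y (generalizedPetersenAdj_of_mem h)
  have hloc : ∀ s, ∀ x ∈ generalizedPetersenNbr 10 2 s, ∀ y ∈ generalizedPetersenNbr 10 2 s,
      x ≠ y → f x ≠ f y := by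
    intro s x hx y hy hxy h
    rcases dodecahedronGraph_walk_of_adj s x hx y hy with h' | ⟨z, hz, w, hw, h'⟩
    · exact hxy h'
    · exact absurd (h ▸ hadj _ _ h') (hG.triangle (hmem _ _ hz) (hmem _ _ hw))
  have hsymm : ∀ x y, y ∈ generalizedPetersenNbr 10 2 x → x ∈ generalizedPetersenNbr 10 2 y := by
    rintro (i | i) y h <;> simp [generalizedPetersenNbr] at h <;>
      rcases h with rfl | rfl | rfl <;> simp [generalizedPetersenNbr]
  have hwalk := dodecahedronGraph_walk b t
  revert hst hwalk
  generalize (if b then .inl 0 else .inr 0 : ZMod 10 ⊕ ZMod 10) = s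
  intro hst hwalk
  rcases hwalk with h | h | ⟨x, hx, y, hy, h | ⟨z, hz, hsy, hxz, h⟩⟩
  · exact h
  · exact absurd (hst ▸ hadj _ _ h) (G.irrefl)
  · exact absurd (hst ▸ hadj _ _ h) (hG.triangle (hmem _ _ hx) (hmem _ _ hy))
  have hsy' : f s ≠ f y := hloc x s (hsymm _ _ hx) y hy hsy
  have hxz' : f x ≠ f z := hloc y x (hsymm _ _ hy) z hz hxz
  rcases h with h | ⟨w, hw, h, m, hm, hzm, n, hn, hns⟩
  · exact absurd
      (hG.square (hmem _ _ hx) (hmem _ _ hy) (hmem _ _ hz) (hst ▸ hadj _ _ h) hsy') hxz'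
  · refine absurd ?_ (hloc y z hz m hm hzm)
    exact hu (hmem _ _ hx) (hmem _ _ hy) hsy' (hst ▸ (hadj _ _ h).symm) (hmem _ _ hw).symm
      (hmem _ _ hz).symm (hadj _ _ hns).symm (hmem _ _ hn).symm (hmem _ _ hm).symm

theorem nonempty_iso_dodecahedronGraph (hG : G.IsGapCubic) (hconn : G.Connected)
    (hu : ∀ {a b c s t s' t'}, G.Adj a b → G.Adj b c → a ≠ c → G.Adj a s → G.Adj s t → G.Adj t c →
      G.Adj a s' → G.Adj s' t' → G.Adj t' c → t = t')
    (f : ZMod 10 ⊕ ZMod 10 → V)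
    (h₁ : ∀ i, G.Adj (f (.inl i)) (f (.inl (i + 1)))) (h₂ : ∀ i, G.Adj (f (.inl i)) (f (.inr i)))
    (h₃ : ∀ i, G.Adj (f (.inr i)) (f (.inr (i + 2)))) : Nonempty (G ≃g dodecahedronGraph) := by
  have hadj := adj_of_hom (n := 10) (k := 2) h₁ h₂ h₃
  refine hG.nonempty_iso_of_injective hconn f ?_
    (fun x y h => hadj x y ((dodecahedronGraph_adj_iff x y).1 h)) fun s =>
      exists_three_adj (dodecahedronGraph_adj_iff) (by decide) (by decide) s
  -- a rotation moves any vertex to index `0`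
  have key := fun i => hG.injective_of_dodecahedron_hom hu (f ∘ Sum.map (· + i) (· + i))
    (fun j => by simpa [add_right_comm] using h₁ (j + i)) (fun j => by simpa using h₂ (j + i))
    (fun j => by simpa [add_right_comm] using h₃ (j + i))
  have hinj : ∀ i : ZMod 10, (Sum.map (· - i) (· - i) : ZMod 10 ⊕ ZMod 10 → _).Injective :=
    fun i => Sum.map_injective.2 ⟨sub_left_injective, sub_left_injective⟩
  have hback : ∀ (i : ZMod 10) t, Sum.map (· + i) (· + i) (Sum.map (· - i) (· - i) t) = t := by
    rintro i (j | j) <;> simp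
  rintro (i | i) t hst
  · exact hinj i (by simpa using key i true (Sum.map (· - i) (· - i) t) (by
      simpa [hback] using hst))
  · exact hinj i (by simpa using key i false (Sum.map (· - i) (· - i) t) (by
      simpa [hback] using hst))

end IsGapCubic
end SimpleGraph

/-! ### Unique pentagons: the dodecahedron -/

namespace SimpleGraph
variable {V : Type*} [Fintype V] [DecidableEq V] {G : SimpleGraph V} [DecidableRel G.Adj]

/-- No path with three vertices lies on two different pentagons. -/
def PentagonUnique {V : Type*} (G : SimpleGraph V) : Prop :=
  ∀ ⦃a b c s t s' t'⦄, G.Adj a b → G.Adj b c → a ≠ c → G.Adj a s → G.Adj s t → G.Adj t c →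
    G.Adj a s' → G.Adj s' t' → G.Adj t' c → s = s'

namespace IsGapCubic

/-- A path `d`, `b`, `c`, `e` whose vertices `d`, `e` lie outside of a pentagon
`a`, `b`, `c`, `t`, `s` closes up to a pentagon. -/
theorem exists_adj_adj_of_pentagon (hG : G.IsGapCubic)
    (hT : ∀ a b c, G.Adj a b → G.Adj b c → a ≠ c → G.ThreeWalk a c) (hu : G.PentagonUnique)
    {a b c s t d e : V} (has : G.Adj a s) (hst : G.Adj s t) (hb : G.IsNbrTriple b a c d)
    (hc : G.IsNbrTriple c b t e) : ∃ x, G.Adj d x ∧ G.Adj x e := by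
  have hbd : G.Adj b d := by simp [hb.adj_iff]
  have hba : G.Adj b a := by simp [hb.adj_iff]
  have hbc : G.Adj b c := by simp [hb.adj_iff]
  have hct : G.Adj c t := by simp [hc.adj_iff]
  obtain ⟨s', t', h1, h2, h3⟩ := hT d b c hbd.symm hbc hb.ne₂₃.symm
  rcases (hc.adj_iff t').1 h3.symm with rfl | rfl | rfl
  · exact absurd hbd (hG.triangle h1 h2)
  · exact absurd (hu hbc hct hc.ne₁₂ hba has hst hbd h1 h2) hb.ne₁₃
  · exact ⟨s', h1, h2⟩

/-- The graph is unfolded around the face `v`: `w i` are the third neighbours of the `v i`, `x i`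
are the tips of the five adjacent faces, and `y i` are the third neighbours of the `x i`. Closing
the faces at `x (i - 1)`, `w i`, `x i` makes the `y i` the opposite face. -/
theorem nonempty_iso_dodecahedronGraph_of_pentagonUnique (hG : G.IsGapCubic) (hconn : G.Connected)
    (hT : ∀ a b c, G.Adj a b → G.Adj b c → a ≠ c → G.ThreeWalk a c) (hu : G.PentagonUnique)
    (v : ZMod 5 → V) (hv : ∀ i, G.Adj (v i) (v (i + 1))) (hne : ∀ i, v (i - 1) ≠ v (i + 1)) :
    Nonempty (G ≃g dodecahedronGraph) := by
  have hv' : ∀ i, G.Adj (v (i - 1)) (v i) := fun i => by simpa using hv (i - 1)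
  have key := @hG.exists_adj_adj_of_pentagon _ _ _ _ _ hT hu
  choose w hw using fun i => hG.exists_third (hv' i).symm (hv i) (hne i)
  have hvw : ∀ i, G.Adj (v i) (w i) := fun i => by simp [(hw i).adj_iff]
  have hx : ∀ i, ∃ x, G.Adj (w i) x ∧ G.Adj x (w (i + 1)) := by
    intro i
    -- The indices from `i - 1` to `i + 3` run once round `ZMod 5`.
    have h1 : G.Adj (v (i - 1)) (v (i + 1 + 1 + 1)) := by
      have h := hv' (i - 1)
      have e : i + 1 + 1 + 1 = i - 1 - 1 := by
        have : (5 : ZMod 5) = 0 := rfl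
        linear_combination this
      rw [e]
      exact h.symm
    have h2 := hw (i + 1)
    rw [add_sub_cancel_right] at h2
    exact key h1 (hv (i + 1 + 1)).symm (hw i) h2
  choose x hwx hxw using hx
  have hxw' : ∀ i, G.Adj (x (i - 1)) (w i) := fun i => by simpa using hxw (i - 1)
  have hvx : ∀ i, v i ≠ x i := by
    intro i h
    exact hG.triangle (hv i) (hvw (i + 1)) (h ▸ hxw i).symm
  have hvx' : ∀ i, v i ≠ x (i - 1) := by
    intro i h
    exact hG.triangle (hv' i).symm (hvw (i - 1)) (h ▸ hwx (i - 1))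
  have hxx : ∀ i, x (i - 1) ≠ x i := by
    intro i h
    have h1 := hwx (i - 1)
    rw [h] at h1
    exact hne i (hu (hvw i) (hwx i) (hvx i) (hv' i).symm (hvw (i - 1)) h1
      (hv i) (hvw (i + 1)) (hxw i).symm)
  have hww : ∀ i, w i ≠ w (i + 1) := by
    intro i h
    exact hG.triangle (hv i) (hvw (i + 1)) (h ▸ hvw i).symm
  choose y hy using fun i => hG.exists_third (hwx i).symm (hxw i) (hww i)
  have hxy : ∀ i, G.Adj (x i) (y i) := fun i => by simp [(hy i).adj_iff]
  have hw' : ∀ i, G.IsNbrTriple (w i) (x (i - 1)) (v i) (x i) := by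
    intro i
    obtain ⟨z, hz⟩ := hG.exists_third (hxw' i).symm (hvw i).symm (hvx' i).symm
    have : x i = z := by
      have := (hz.adj_iff (x i)).1 (hwx i)
      have := hvx i
      have := hxx i
      grind
    exact this ▸ hz
  have hyy : ∀ i, G.Adj (y (i - 1)) (y i) := by
    intro i
    have h1 := hy (i - 1)
    rw [sub_add_cancel] at h1
    obtain ⟨z, hz, hz'⟩ := key (hvw (i - 1)).symm (hv' i) h1 (hw' i)
    rcases ((hy i).adj_iff z).1 hz'.symm with rfl | rfl | rfl
    · exact absurd hz (hG.triangle (hxw' i).symm (hxy (i - 1)))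
    · exact absurd (hu (hwx i) (hxw i) (hww i) (hvw i).symm (hv i) (hvw (i + 1))
        (hxw' i).symm (hxy (i - 1)) hz) (hvx' i)
    · exact hz
  have hyy' : ∀ i, G.Adj (y i) (y (i + 1)) := fun i => by simpa using hyy (i + 1)
  -- The `w i` and `x i` alternate on the 10-cycle; `v` and `y` are the inner pentagons on the even
  -- and odd indices.
  refine hG.nonempty_iso_dodecahedronGraph hconn ?_
    (Sum.elim ![w 0, x 0, w 1, x 1, w 2, x 2, w 3, x 3, w 4, x 4]
      ![v 0, y 0, v 1, y 1, v 2, y 2, v 3, y 3, v 4, y 4]) ?_ ?_ ?_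
  -- Here the vertices next to `c` are compared, so both pentagons are read backwards.
  · intro a b c s t s' t' h1 h2 h3 h4 h5 h6 h7 h8 h9
    exact hu h2.symm h1.symm h3.symm h6.symm h5.symm h4.symm h9.symm h8.symm h7.symm
  · intro i
    fin_cases i
    exacts [hwx 0, hxw 0, hwx 1, hxw 1, hwx 2, hxw 2, hwx 3, hxw 3, hwx 4, hxw 4]
  · intro i
    fin_cases i
    exacts [(hvw 0).symm, hxy 0, (hvw 1).symm, hxy 1, (hvw 2).symm, hxy 2, (hvw 3).symm, hxy 3,
      (hvw 4).symm, hxy 4]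
  · intro i
    fin_cases i
    exacts [hv 0, hyy' 0, hv 1, hyy' 1, hv 2, hyy' 2, hv 3, hyy' 3, hv 4, hyy' 4]

end IsGapCubic
end SimpleGraph

/-! ### Pentagons sharing a path: the Petersen graph -/

namespace SimpleGraph
variable {V : Type*} [Fintype V] [DecidableEq V] {G : SimpleGraph V} [DecidableRel G.Adj]

theorem IsNbrTriple.swap {V : Type*} {G : SimpleGraph V} {u x y z : V}
    (h : G.IsNbrTriple u x y z) : G.IsNbrTriple u x z y :=
  ⟨fun t => by rw [h.adj_iff, or_comm (a := t = y)], h.ne₁₃, h.ne₁₂, h.ne₂₃.symm⟩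

theorem IsNbrTriple.facts {V : Type*} {G : SimpleGraph V} {u x y z : V}
    (h : G.IsNbrTriple u x y z) : (∀ t, G.Adj u t ↔ t = x ∨ t = y ∨ t = z) ∧ x ≠ y ∧ x ≠ z ∧
      y ≠ z ∧ G.Adj u x ∧ G.Adj u y ∧ G.Adj u z ∧ G.Adj x u ∧ G.Adj y u ∧ G.Adj z u := by
  have hx : G.Adj u x := by simp [h.adj_iff]
  have hy : G.Adj u y := by simp [h.adj_iff]
  have hz : G.Adj u z := by simp [h.adj_iff]
  exact ⟨h.adj_iff, h.ne₁₂, h.ne₁₃, h.ne₂₃, hx, hy, hz, hx.symm, hy.symm, hz.symm⟩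

/-- Two pentagons sharing the path `a`, `b`, `c` and a third pentagon through `a`, `b`, `d`. -/
structure IsTheta {V : Type*} (G : SimpleGraph V) (a b c d a₁ a₂ c₁ c₂ d₁ d₂ : V) : Prop where
  hb : G.IsNbrTriple b a c d
  ha : G.IsNbrTriple a b a₁ a₂
  hc : G.IsNbrTriple c b c₁ c₂
  hd : G.IsNbrTriple d b d₁ d₂
  ha₁ : G.IsNbrTriple a₁ a c₁ d₁
  adj : G.Adj a₂ c₂

namespace IsGapCubic

/-- This drives the case analyses below: the pentagon at `u`, `m`, `e` places `e` next to a vertex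
near `u`, and vertices whose three neighbours are already known are excluded. -/
theorem exists_adj_of_threeWalk (hG : G.IsGapCubic)
    (hT : ∀ a b c, G.Adj a b → G.Adj b c → a ≠ c → G.ThreeWalk a c) {u m e p q : V}
    (hu : G.IsNbrTriple u p q m) (hme : G.Adj m e) (hue : u ≠ e) :
    ∃ x, x ≠ u ∧ G.Adj x e ∧ (G.Adj p x ∨ G.Adj q x) := by
  have hum : G.Adj u m := by simp [hu.adj_iff]
  obtain ⟨y, x, h1, h2, h3⟩ := hT u m e hum hme hue
  refine ⟨x, ?_, h3, ?_⟩
  · rintro rfl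
    exact hG.triangle hum hme h3.symm
  · rcases (hu.adj_iff y).1 h1 with rfl | rfl | rfl
    · exact .inl h2
    · exact .inr h2
    · exact absurd hme.symm (hG.triangle h2 h3)

theorem nodup_of_isNbrTriple (hG : G.IsGapCubic) {a b c d a₁ a₂ c₁ c₂ d₁ d₂ : V}
    (hb : G.IsNbrTriple b a c d) (ha : G.IsNbrTriple a b a₁ a₂) (hc : G.IsNbrTriple c b c₁ c₂)
    (hd : G.IsNbrTriple d b d₁ d₂) : [b, a, c, d, a₁, a₂, c₁, c₂, d₁, d₂].Nodup := by
  have key : ∀ p q x y, G.Adj b p → G.Adj b q → p ≠ q → G.Adj p x → x ≠ b → G.Adj q y →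
      x ≠ y := by
    rintro p q x y h1 h2 h3 h4 h5 h6 rfl
    exact h3 (hG.square h1 h4 h6.symm h2.symm h5.symm)
  have key' : ∀ p q x, G.Adj b p → G.Adj b q → G.Adj p x → x ≠ q := by
    rintro p q x h1 h2 h3 rfl
    exact hG.triangle h1 h3 h2.symm
  have e1 : G.Adj b a := by simp [hb.adj_iff]
  have e2 : G.Adj b c := by simp [hb.adj_iff]
  have e3 : G.Adj b d := by simp [hb.adj_iff]
  have e4 : G.Adj a a₁ := by simp [ha.adj_iff]
  have e5 : G.Adj a a₂ := by simp [ha.adj_iff]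
  have e6 : G.Adj c c₁ := by simp [hc.adj_iff]
  have e7 : G.Adj c c₂ := by simp [hc.adj_iff]
  have e8 : G.Adj d d₁ := by simp [hd.adj_iff]
  have e9 : G.Adj d d₂ := by simp [hd.adj_iff]
  have := hb.ne₁₂
  have := hb.ne₁₃
  have := hb.ne₂₃
  have := ha.ne₁₂
  have := ha.ne₁₃
  have := ha.ne₂₃
  have := hc.ne₁₂
  have := hc.ne₁₃
  have := hc.ne₂₃
  have := hd.ne₁₂
  have := hd.ne₁₃
  have := hd.ne₂₃
  have := key a c a₁ c₁ e1 e2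
  have := key a c a₁ c₂ e1 e2
  have := key a c a₂ c₁ e1 e2
  have := key a c a₂ c₂ e1 e2
  have := key a d a₁ d₁ e1 e3
  have := key a d a₁ d₂ e1 e3
  have := key a d a₂ d₁ e1 e3
  have := key a d a₂ d₂ e1 e3
  have := key c d c₁ d₁ e2 e3
  have := key c d c₁ d₂ e2 e3
  have := key c d c₂ d₁ e2 e3
  have := key c d c₂ d₂ e2 e3
  have := key' a a a₁ e1 e1
  have := key' a c a₁ e1 e2
  have := key' a d a₁ e1 e3
  have := key' a a a₂ e1 e1
  have := key' a c a₂ e1 e2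
  have := key' a d a₂ e1 e3
  have := key' c a c₁ e2 e1
  have := key' c c c₁ e2 e2
  have := key' c d c₁ e2 e3
  have := key' c a c₂ e2 e1
  have := key' c c c₂ e2 e2
  have := key' c d c₂ e2 e3
  have := key' d a d₁ e3 e1
  have := key' d c d₁ e3 e2
  have := key' d d d₁ e3 e3
  have := key' d a d₂ e3 e1
  have := key' d c d₂ e3 e2
  have := key' d d d₂ e3 e3
  have := e1.ne
  have := e2.ne
  have := e3.ne
  simp only [List.nodup_cons, List.mem_cons, List.not_mem_nil, not_or, or_false,
    not_false_eq_true, List.nodup_nil, and_true]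
  clear key key'
  clear hb ha hc hd hG
  grind

theorem _root_.SimpleGraph.IsTheta.not_adj₁ {a b c d a₁ a₂ c₁ c₂ d₁ d₂ : V} (hG : G.IsGapCubic)
    (h : IsTheta G a b c d a₁ a₂ c₁ c₂ d₁ d₂) : ¬ G.Adj a₂ c₁ := by
  have h1 := h.ha.facts
  have h2 := h.ha₁.facts
  exact fun h' => h.ha.ne₂₃ (hG.square (x := a) (z := c₁) (by grind) (by grind) h'.symm (by grind)
    h.ha₁.ne₁₂)

theorem _root_.SimpleGraph.IsTheta.not_adj₂ {a b c d a₁ a₂ c₁ c₂ d₁ d₂ : V} (hG : G.IsGapCubic)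
    (h : IsTheta G a b c d a₁ a₂ c₁ c₂ d₁ d₂) : ¬ G.Adj a₂ d₁ := by
  have h1 := h.ha.facts
  have h2 := h.ha₁.facts
  exact fun h' => h.ha.ne₂₃ (hG.square (x := a) (z := d₁) (by grind) (by grind) h'.symm (by grind)
    h.ha₁.ne₁₃)

theorem _root_.SimpleGraph.IsTheta.not_adj₃ {a b c d a₁ a₂ c₁ c₂ d₁ d₂ : V} (hG : G.IsGapCubic)
    (h : IsTheta G a b c d a₁ a₂ c₁ c₂ d₁ d₂) : ¬ G.Adj c₁ d₁ := by
  have h2 := h.ha₁.facts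
  exact fun h' => hG.triangle (x := a₁) (by grind) h' (by grind)

/-- Otherwise the pentagon at `a`, `a₂`, `e`, with `e` the third neighbour of `a₂`, forces an edge
from `d₁` to `e`. Then `e` and `c₁` are both opposite to `b` in hexagons at `a`, `b`, `d`, against
`hexAt_unique`. -/
theorem _root_.SimpleGraph.IsTheta.adj_of_adj₁ (hG : G.IsGapCubic)
    (hT : ∀ a b c, G.Adj a b → G.Adj b c → a ≠ c → G.ThreeWalk a c)
    {a b c d a₁ a₂ c₁ c₂ d₁ d₂ : V} (h : IsTheta G a b c d a₁ a₂ c₁ c₂ d₁ d₂)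
    (h₄ : G.Adj c₁ d₂) : G.Adj a₂ d₂ := by
  have hnd := hG.nodup_of_isNbrTriple h.hb h.ha h.hc h.hd
  simp only [List.nodup_cons, List.mem_cons, List.not_mem_nil, not_or, or_false,
    not_false_eq_true, List.nodup_nil, and_true] at hnd
  have hn₁ := h.not_adj₁ hG
  have hn₂ := h.not_adj₂ hG
  have hn₃ := h.not_adj₃ hG
  obtain ⟨hb, ha, hc, hd, ha₁, h₂⟩ := h
  have hbf := hb.facts
  have haf := ha.facts
  have hcf := hc.facts
  have hdf := hd.facts
  have ha₁f := ha₁.facts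
  by_contra hn
  obtain ⟨t, hc₁⟩ := hG.exists_third (u := c₁) (x := c) (y := a₁) (by grind) (by grind) (by grind)
  have hc₁f := hc₁.facts
  obtain rfl : d₂ = t := by grind
  obtain ⟨e, ha₂⟩ := hG.exists_third (u := a₂) (x := a) (y := c₂) (by grind) h₂ (by grind)
  have ha₂f := ha₂.facts
  obtain ⟨x, h1, h2, h3⟩ := hG.exists_adj_of_threeWalk hT (m := a₂) (e := e) ha (by grind) ha₂.ne₁₃
  have hs := h2.symm
  have hd₁e : G.Adj d₁ e := by
    clear hG hT hb ha hc hd ha₁ hc₁ ha₂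
    grind
  have hed₁ := hd₁e.symm
  have : e = c₁ := hG.hexAt_unique (s := a₂) (t := d₁) (s' := a₁) (t' := d₂) hb.ne₁₃ ha hd
    (by grind) hn
    ⟨by grind, by grind, by grind, by grind, by grind, by grind⟩
    ⟨by grind, by grind, by grind, by grind, by grind, by grind⟩
  grind

/-- Otherwise the third neighbour `e` of `a₂` is also that of `c₁`, and the vertices through which a
pentagon at `d`, `d₂`, `h` would have to pass are all saturated. -/
theorem _root_.SimpleGraph.IsTheta.adj_of_adj₂ (hG : G.IsGapCubic)
    (hT : ∀ a b c, G.Adj a b → G.Adj b c → a ≠ c → G.ThreeWalk a c)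
    {a b c d a₁ a₂ c₁ c₂ d₁ d₂ : V} (h : IsTheta G a b c d a₁ a₂ c₁ c₂ d₁ d₂)
    (h₄ : G.Adj c₂ d₁) : G.Adj a₂ d₂ := by
  have hnd := hG.nodup_of_isNbrTriple h.hb h.ha h.hc h.hd
  simp only [List.nodup_cons, List.mem_cons, List.not_mem_nil, not_or, or_false,
    not_false_eq_true, List.nodup_nil, and_true] at hnd
  have hn₁ := h.not_adj₁ hG
  have hn₂ := h.not_adj₂ hG
  have hn₃ := h.not_adj₃ hG
  obtain ⟨hb, ha, hc, hd, ha₁, h₂⟩ := h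
  have hbf := hb.facts
  have haf := ha.facts
  have hcf := hc.facts
  have hdf := hd.facts
  have ha₁f := ha₁.facts
  by_contra hn
  obtain ⟨t, hc₂⟩ := hG.exists_third (u := c₂) (x := c) (y := a₂) (by grind) h₂.symm (by grind)
  have hc₂f := hc₂.facts
  obtain rfl : d₁ = t := by grind
  obtain ⟨t, hd₁⟩ := hG.exists_third (u := d₁) (x := d) (y := a₁) (by grind) (by grind) (by grind)
  have hd₁f := hd₁.facts
  obtain rfl : c₂ = t := by grind
  obtain ⟨e, ha₂⟩ := hG.exists_third (u := a₂) (x := a) (y := c₂) (by grind) h₂ (by grind)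
  have ha₂f := ha₂.facts
  have hc₁e : G.Adj c₁ e := by
    obtain ⟨x, h1, h2, h3⟩ := hG.exists_adj_of_threeWalk hT (m := a₂) (e := e) ha (by grind)
      ha₂.ne₁₃
    have hs := h2.symm
    clear hG hT hb ha hc hd ha₁ hc₂ ha₂ hd₁
    grind
  obtain ⟨t, hc₁⟩ := hG.exists_third (u := c₁) (x := c) (y := a₁) (by grind) (by grind) (by grind)
  have hc₁f := hc₁.facts
  obtain rfl : e = t := by
    have := (hc₁.adj_iff e).1 hc₁e
    clear hG hT
    grind
  obtain ⟨g, h, hd₂⟩ := hG.exists_triple (u := d₂) (x := d) (by grind)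
  have hd₂f := hd₂.facts
  obtain ⟨x, h1, h2, h3⟩ := hG.exists_adj_of_threeWalk hT (m := d₂) (e := h) hd (by grind) hd₂.ne₁₃
  have hs := h2.symm
  clear hG hT hb ha hc hd ha₁ hc₂ ha₂ hd₁ hc₁ hd₂
  grind

theorem _root_.SimpleGraph.IsTheta.adj_of_adj₃ (hG : G.IsGapCubic)
    (hT : ∀ a b c, G.Adj a b → G.Adj b c → a ≠ c → G.ThreeWalk a c)
    {a b c d a₁ a₂ c₁ c₂ d₁ d₂ : V} (h : IsTheta G a b c d a₁ a₂ c₁ c₂ d₁ d₂)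
    (h₄ : G.Adj c₂ d₁) : G.Adj c₁ d₂ := by
  have h₅ := h.adj_of_adj₂ hG hT h₄
  have hnd := hG.nodup_of_isNbrTriple h.hb h.ha h.hc h.hd
  simp only [List.nodup_cons, List.mem_cons, List.not_mem_nil, not_or, or_false,
    not_false_eq_true, List.nodup_nil, and_true] at hnd
  have hn₁ := h.not_adj₁ hG
  have hn₂ := h.not_adj₂ hG
  have hn₃ := h.not_adj₃ hG
  obtain ⟨hb, ha, hc, hd, ha₁, h₂⟩ := h
  have hbf := hb.facts
  have haf := ha.facts
  have hcf := hc.facts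
  have hdf := hd.facts
  have ha₁f := ha₁.facts
  by_contra hn
  obtain ⟨t, hc₂⟩ := hG.exists_third (u := c₂) (x := c) (y := a₂) (by grind) h₂.symm (by grind)
  have hc₂f := hc₂.facts
  obtain rfl : d₁ = t := by grind
  obtain ⟨t, hd₁⟩ := hG.exists_third (u := d₁) (x := d) (y := a₁) (by grind) (by grind) (by grind)
  have hd₁f := hd₁.facts
  obtain rfl : c₂ = t := by grind
  obtain ⟨e, ha₂⟩ := hG.exists_third (u := a₂) (x := a) (y := c₂) (by grind) h₂ (by grind)
  have ha₂f := ha₂.facts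
  obtain rfl : d₂ = e := by grind
  obtain ⟨f, hc₁⟩ := hG.exists_third (u := c₁) (x := c) (y := a₁) (by grind) (by grind) (by grind)
  have hc₁f := hc₁.facts
  obtain ⟨x, h1, h2, h3⟩ := hG.exists_adj_of_threeWalk hT (m := c₁) (e := f) hc.swap (by grind)
    hc₁.ne₁₃
  have hs := h2.symm
  clear hG hT hb ha hc hd ha₁ hc₂ ha₂ hd₁ hc₁
  grind

/-- Suppose the edge exists. Two uses of `hexAt_unique`, at `a`, `b`, `d` and at `c`, `b`, `d`, keep
`e` away from `d₁` and `d₂`. The pentagons at further paths then determine all edges up to `g` and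
`h`, and no pentagon is left for `c₁`, `e`, `f`. -/
theorem _root_.SimpleGraph.IsTheta.not_adj (hG : G.IsGapCubic)
    (hT : ∀ a b c, G.Adj a b → G.Adj b c → a ≠ c → G.ThreeWalk a c)
    {a b c d a₁ a₂ c₁ c₂ d₁ d₂ : V} (h : IsTheta G a b c d a₁ a₂ c₁ c₂ d₁ d₂)
    : ¬ G.Adj c₂ d₂ := by
  have hnd := hG.nodup_of_isNbrTriple h.hb h.ha h.hc h.hd
  simp only [List.nodup_cons, List.mem_cons, List.not_mem_nil, not_or, or_false,
    not_false_eq_true, List.nodup_nil, and_true] at hnd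
  have hn₁ := h.not_adj₁ hG
  have hn₂ := h.not_adj₂ hG
  have hn₃ := h.not_adj₃ hG
  obtain ⟨hb, ha, hc, hd, ha₁, h₂⟩ := h
  have hbf := hb.facts
  have haf := ha.facts
  have hcf := hc.facts
  have hdf := hd.facts
  have ha₁f := ha₁.facts
  intro h₄
  have hn₄ : ¬ G.Adj a₂ d₂ := fun h => hG.triangle h₂ h₄ h.symm
  obtain ⟨t, hc₂⟩ := hG.exists_third (u := c₂) (x := c) (y := a₂) (by grind) h₂.symm (by grind)
  have hc₂f := hc₂.facts
  obtain rfl : d₂ = t := by grind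
  obtain ⟨e, ha₂⟩ := hG.exists_third (u := a₂) (x := a) (y := c₂) (by grind) h₂ (by grind)
  have ha₂f := ha₂.facts
  have hd₁e : ¬ G.Adj d₁ e := by
    intro hd₁e
    have hed₁ := hd₁e.symm
    have : e = c₂ := hG.hexAt_unique (s := a₂) (t := d₁) (s' := a₂) (t' := d₂) hb.ne₁₃ ha hd
      (by grind) hn₄
      ⟨by grind, by grind, by grind, by grind, by grind, by grind⟩
      ⟨by grind, by grind, by grind, by grind, by grind, by grind⟩
    grind
  have hc₁e : G.Adj c₁ e := by
    obtain ⟨x, h1, h2, h3⟩ := hG.exists_adj_of_threeWalk hT (m := a₂) (e := e) ha (by grind)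
      ha₂.ne₁₃
    have hs := h2.symm
    clear hG hT hb ha hc hd ha₁ hc₂ ha₂
    grind
  obtain ⟨t, hc₁⟩ := hG.exists_third (u := c₁) (x := c) (y := a₁) (by grind) (by grind) (by grind)
  have hc₁f := hc₁.facts
  obtain rfl : e = t := by
    have := (hc₁.adj_iff e).1 hc₁e
    clear hG hT
    grind
  obtain ⟨g, hd₂⟩ := hG.exists_third (u := d₂) (x := d) (y := c₂) (by grind) (by grind) (by grind)
  have hd₂f := hd₂.facts
  have hge : g ≠ e := by
    rintro rfl
    have : g = a₁ := hG.hexAt_unique (s := c₁) (t := d₂) (s' := c₁) (t' := d₁) hb.ne₂₃ hc.swap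
      hd.swap h₄ hn₃
      ⟨by grind, by grind, by grind, by grind, by grind, by grind⟩
      ⟨by grind, by grind, by grind, by grind, by grind, by grind⟩
    grind
  obtain ⟨h, hd₁⟩ := hG.exists_third (u := d₁) (x := d) (y := a₁) (by grind) (by grind) (by grind)
  have hd₁f := hd₁.facts
  have hgh : G.Adj g h := by
    obtain ⟨x, h1, h2, h3⟩ := hG.exists_adj_of_threeWalk hT (m := d₁) (e := h) hd.swap (by grind)
      hd₁.ne₁₃
    have hs := h2.symm
    clear hG hT hb ha hc hd ha₁ hc₂ ha₂ hc₁ hd₂ hd₁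
    grind
  obtain ⟨f, he⟩ := hG.exists_third (u := e) (x := a₂) (y := c₁) (by grind) (by grind) (by grind)
  have hef := he.facts
  obtain rfl : f = g := by
    obtain ⟨x, h1, h2, h3⟩ := hG.exists_adj_of_threeWalk hT (m := e) (e := f) ha₂ (by grind)
      he.ne₁₃
    have hs := h2.symm
    clear hG hT hb ha hc hd ha₁ hc₂ ha₂ hc₁ hd₂ hd₁ he
    grind
  obtain ⟨x, h1, h2, h3⟩ := hG.exists_adj_of_threeWalk hT (m := e) (e := f) hc₁ (by grind)
    he.ne₂₃
  have hs := h2.symm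
  have hgh' := hgh.ne
  clear hG hT hb ha hc hd ha₁ hc₂ ha₂ hc₁ hd₂ hd₁ he
  grind

end IsGapCubic
end SimpleGraph

namespace SimpleGraph
variable {V : Type*} [Fintype V] [DecidableEq V] {G : SimpleGraph V} [DecidableRel G.Adj]

theorem IsNbrTriple.eq_third {V : Type*} {G : SimpleGraph V} {u x y z t : V}
    (h : G.IsNbrTriple u x y z) (ht : G.Adj u t) (hx : x ≠ t) (hy : y ≠ t) : t = z := by
  have := (h.adj_iff t).1 ht
  grind

namespace IsGapCubic

theorem exists_triple_eq (hG : G.IsGapCubic) {u x y z : V} (hx : G.Adj u x) (hy : G.Adj u y)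
    (hz : G.Adj u z) (hxy : x ≠ y) (hxz : x ≠ z) (hyz : y ≠ z) : G.IsNbrTriple u x y z := by
  obtain ⟨t, ht⟩ := hG.exists_third hx hy hxy
  exact ht.eq_third hz hxz hyz ▸ ht

/-- The vertices at distance two from `b` must form the hexagon `a₁`, `c₁`, `d₂`, `a₂`, `c₂`, `d₁`.
A pentagon at `c`, `b`, `d` supplies one more edge, and the previous lemmas settle each choice of
it. -/
theorem _root_.SimpleGraph.IsTheta.exists_hexagon (hG : G.IsGapCubic)
    (hT : ∀ a b c, G.Adj a b → G.Adj b c → a ≠ c → G.ThreeWalk a c)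
    {a b c d a₁ a₂ c₁ c₂ d₁ d₂ : V} (h : IsTheta G a b c d a₁ a₂ c₁ c₂ d₁ d₂) :
    G.Adj c₁ d₂ ∧ G.Adj a₂ d₂ ∧ G.Adj c₂ d₁ := by
  have hbf := h.hb.facts
  have hcf := h.hc.facts
  have hdf := h.hd.facts
  have haf := h.ha₁.facts
  obtain ⟨p, q, h1, h2, h3⟩ := hT c b d (by grind) (by grind) h.hb.ne₂₃
  rcases (h.hc.adj_iff p).1 h1 with rfl | rfl | rfl
  · exact absurd (h3.symm) (fun h' => hG.triangle h2 h'.symm (by grind))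
  all_goals rcases (h.hd.adj_iff q).1 h3.symm with rfl | rfl | rfl
  · exact absurd h2 (fun h' => hG.triangle h1 h2 (by grind))
  · exact absurd h2 (h.not_adj₃ hG)
  · refine ⟨h2, h.adj_of_adj₁ hG hT h2, ?_⟩
    -- The configuration is symmetric under exchanging `a` with `c` and `d₁` with `d₂`; the same
    -- lemma then gives the last edge.
    have h' : IsTheta G c b a d p c₂ a₁ a₂ q d₁ := by
      refine ⟨⟨fun t => by grind, by grind, by grind, by grind⟩, h.hc, h.ha, h.hd.swap, ?_,
        h.adj.symm⟩
      refine hG.exists_triple_eq h1.symm (by grind) h2 ?_ ?_ ?_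
      · rintro rfl
        exact hG.triangle (x := b) (y := c) (z := a) (by grind) (by grind) (by grind)
      · rintro rfl
        exact hG.triangle (x := b) (y := c) (z := d) (by grind) (by grind) (by grind)
      · have hnd := hG.nodup_of_isNbrTriple h.hb h.ha h.hc h.hd
        simp only [List.nodup_cons, List.mem_cons, List.not_mem_nil, not_or, or_false,
          not_false_eq_true, List.nodup_nil, and_true] at hnd
        grind
    exact h'.adj_of_adj₁ hG hT (by grind)
  · exact absurd h2 (fun h' => hG.triangle h1 h2 (by grind))
  · exact ⟨h.adj_of_adj₃ hG hT h2, h.adj_of_adj₂ hG hT h2, h2⟩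
  · exact absurd h2 (h.not_adj hG hT)

theorem _root_.SimpleGraph.IsTheta.nonempty_iso (hG : G.IsGapCubic) (hconn : G.Connected)
    (hT : ∀ a b c, G.Adj a b → G.Adj b c → a ≠ c → G.ThreeWalk a c)
    {a b c d a₁ a₂ c₁ c₂ d₁ d₂ : V} (h : IsTheta G a b c d a₁ a₂ c₁ c₂ d₁ d₂) :
    Nonempty (G ≃g petersenGraph) := by
  obtain ⟨h1, h2, h3⟩ := h.exists_hexagon hG hT
  have h4 := h.adj.symm
  have hb := h.hb.facts
  have ha := h.ha.facts
  have hc := h.hc.facts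
  have hd := h.hd.facts
  have ha₁ := h.ha₁.facts
  -- The outer cycle is the pentagon `b`, `a`, `a₁`, `c₁`, `c`; each inner vertex is the third
  -- neighbour of its outer one.
  refine hG.nonempty_iso_petersenGraph hconn
    (Sum.elim ![b, a, a₁, c₁, c] ![d, a₂, d₁, d₂, c₂]) ?_ ?_ ?_
  · intro i
    fin_cases i
    exacts [show G.Adj b a by grind, show G.Adj a a₁ by grind, show G.Adj a₁ c₁ by grind,
      show G.Adj c₁ c by grind, show G.Adj c b by grind]
  · intro i
    fin_cases i
    exacts [show G.Adj b d by grind, show G.Adj a a₂ by grind, show G.Adj a₁ d₁ by grind,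
      h1, show G.Adj c c₂ by grind]
  · intro i
    fin_cases i
    exacts [show G.Adj d d₁ by grind, h2, h3.symm, show G.Adj d₂ d by grind, h4]

/-- Two pentagons on `a`, `b`, `c` differ at both inner vertices, as there are no squares, so they
use all neighbours of `a` and `c`. A pentagon at `a`, `b`, `d` must continue one of them; the labels
are chosen so that this is `a₁`. -/
theorem exists_isTheta (hG : G.IsGapCubic)
    (hT : ∀ a b c, G.Adj a b → G.Adj b c → a ≠ c → G.ThreeWalk a c) (hu : ¬ G.PentagonUnique) :
    ∃ a b c d a₁ a₂ c₁ c₂ d₁ d₂ : V, IsTheta G a b c d a₁ a₂ c₁ c₂ d₁ d₂ := by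
  simp only [PentagonUnique] at hu
  push Not at hu
  obtain ⟨a, b, c, s, t, s', t', hab, hbc, hac, has, hst, htc, has', hst', htc', hss'⟩ := hu
  obtain ⟨d, hb⟩ := hG.exists_third hab.symm hbc hac
  have hbd : G.Adj b d := by simp [hb.adj_iff]
  have hsb : ∀ {s t}, G.Adj a s → G.Adj s t → G.Adj t c → b ≠ s ∧ b ≠ t ∧ a ≠ t := by
    intro s t h1 h2 h3
    refine ⟨?_, ?_, ?_⟩
    · rintro rfl; exact hG.triangle h2 h3 hbc.symm
    · rintro rfl; exact hG.triangle h1 h2 hab.symm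
    · rintro rfl; exact hG.triangle hab hbc h3.symm
  obtain ⟨n1, n2, n3⟩ := hsb has hst htc
  obtain ⟨n1', n2', n3'⟩ := hsb has' hst' htc'
  have htt' : t ≠ t' := by
    rintro rfl
    exact hss' (hG.square has hst hst'.symm has'.symm n3)
  have ha := hG.exists_triple_eq hab has has' n1 n1' hss'
  have hc := hG.exists_triple_eq hbc.symm htc.symm htc'.symm n2 n2' htt'
  obtain ⟨p, q, h1, h2, h3⟩ := hT a b d hab hbd hb.ne₁₃
  have hqb : b ≠ q := by rintro rfl; exact hG.triangle h1 h2 hab.symm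
  have haq : a ≠ q := by rintro rfl; exact hG.triangle hab hbd h3.symm
  obtain ⟨d₂, hd⟩ := hG.exists_third hbd.symm h3.symm hqb
  have hne : ∀ {t}, G.Adj t c → b ≠ t → t ≠ q := by
    rintro t h hbt rfl
    exact hb.ne₂₃ (hG.square hbc h.symm h3 hbd.symm hbt)
  rcases (ha.adj_iff p).1 h1 with rfl | rfl | rfl
  · exact absurd hbd.symm (fun h => hG.triangle h2 h3 h)
  · exact ⟨a, b, c, d, p, s', t, t', q, d₂, hb, ha, hc, hd,
      hG.exists_triple_eq h1.symm hst h2 n3 haq (hne htc n2), hst'⟩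
  · exact ⟨a, b, c, d, p, s, t', t, q, d₂, hb, ha.swap, hc.swap, hd,
      hG.exists_triple_eq h1.symm hst' h2 n3' haq (hne htc' n2'), hst⟩

end IsGapCubic
end SimpleGraph

/-! ### Conclusion -/

/-- A connected finite cubic graph of girth `5` with no adjacency eigenvalue in the open interval
`(-2, 0)` is isomorphic to the Petersen graph or to the dodecahedron. -/
theorem mainTheorem1 {V : Type*} [Fintype V] [DecidableEq V]
    (G : SimpleGraph V) [DecidableRel G.Adj]
    (hconn : G.Connected)
    (hcubic : G.IsRegularOfDegree 3)
    (hgirth : G.girth = 5)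
    (heig : ∀ μ : ℝ, Module.End.HasEigenvalue (Matrix.toLin' (G.adjMatrix ℝ)) μ →
      μ ∉ Set.Ioo (-2 : ℝ) 0) :
    Nonempty (G ≃g petersenGraph) ∨ Nonempty (G ≃g dodecahedronGraph) := by
  have hG : G.IsGapCubic := by
    refine ⟨hcubic, SimpleGraph.not_adj_of_four_le_girth (by omega),
      SimpleGraph.eq_of_adj_of_five_le_girth (by omega),
      Matrix.IsHermitian.posSemidef_mul_self_add_two_smul ?_ heig⟩
    rw [Matrix.IsHermitian, Matrix.conjTranspose_eq_transpose_of_trivial,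
      SimpleGraph.transpose_adjMatrix]
  obtain ⟨a, b, c, d, e, hab, hbc, hcd, hde, hea, hnd⟩ :=
    SimpleGraph.exists_pentagon_of_girth_eq_five hgirth
  simp only [List.nodup_cons, List.mem_cons, List.not_mem_nil, not_or, or_false,
    not_false_eq_true, List.nodup_nil, and_true] at hnd
  have hp : ∀ v, G.OnPentagon v := by
    refine hconn.forall_of_adj (fun u v huv hu => hG.onPentagon_of_adj huv hu) (u := a) ?_
    exact ⟨b, e, by grind, hab, hea.symm, c, d, hbc, hcd, hde⟩
  have hT : ∀ a b c, G.Adj a b → G.Adj b c → a ≠ c → G.ThreeWalk a c := by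
    intro a b c h1 h2 h3
    by_contra h
    exact hG.not_openAngle hp a b c ⟨h1, h2, h3, h⟩
  by_cases hu : G.PentagonUnique
  · right
    refine hG.nonempty_iso_dodecahedronGraph_of_pentagonUnique hconn hT hu ![a, b, c, d, e] ?_ ?_
    · intro i
      fin_cases i
      exacts [hab, hbc, hcd, hde, hea]
    · intro i
      fin_cases i
      exacts [show e ≠ b by grind, show a ≠ c by grind, show b ≠ d by grind, show c ≠ e by grind,
        show d ≠ a by grind]
  · left
    obtain ⟨a, b, c, d, a₁, a₂, c₁, c₂, d₁, d₂, h⟩ := hG.exists_isTheta hT hu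
    exact h.nonempty_iso hG hconn hT
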